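/- Let $p>1$ be real and let $|D|=(-\Delta)^{1/2}$ be the Fourier multiplier with symbol $|\xi|$ on $\mathbb R$. Let $H^1(\mathbb R)$ be the space of complex-valued $f\in L^2(\mathbb R)$ with weak derivative $f'\in L^2(\mathbb R)$, with norm $\|f\|_{H^1}^2=\|f\|_{2}^2+\|f'\|_{2}^2$. For $u_0\in H^1(\mathbb R)$ and $T\in(0,\infty]$, an $H^1(\mathbb R)$ solution on $[0,T)$ of $$\partial_t u=-\mathrm i|D|u+|u|^{p-1}u,\qquad u(0)=u_0, \tag{1}$$ is a function $u\in C([0,T);H^1(\mathbb R))$ with $u(0)=u_0$ which, as an $L^2(\mathbb R)$-valued function, is differentiable at every $t\in[0,T)$ (one-sidedly at $t=0$) and satisfies the equation in $L^2(\mathbb R)$ there. Its lifespan is $T$ if it does not extend to an $H^1(\mathbb R)$ solution on $[0,T')$ for any $T'>T$. For every $f\in H^1(\mathbb R)$ there exist constants $C>0$ and $R_0>0$ such that for every $R\ge R_0$ there is an $H^1(\mathbb R)$ solution of (1) with initial value $u_0=Rf$ whose lifespan $T\in(0,\infty]$ satisfies $$T\ \ge\ C\,R^{-(p-1)} .$$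 -/

import Mathlib

open MeasureTheory Set FourierTransform LineDeriv
open scoped ENNReal SchwartzMap LineDeriv

noncomputable section

namespace FractionalGL

/-- The complex Hilbert space `L²(ℝ)`. -/
abbrev L2 : Type := Lp ℂ 2 (volume : Measure ℝ)

/-- `g` is the derivative of `f` in the sense of tempered distributions. -/
def IsWeakDeriv (f g : L2) : Prop :=
  ∂_{(1 : ℝ)} (f : 𝓢'(ℝ, ℂ)) = (g : 𝓢'(ℝ, ℂ))

/-- The Sobolev space `H¹(ℝ)` of all `f ∈ L²(ℝ)` with weak derivative `f' ∈ L²(ℝ)`, with the norm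
`‖f‖² = ‖f‖²_{L²} + ‖f'‖²_{L²}`. An element is stored as the pair `(f, f')`, and the norm is the
one of the Hilbert sum `L² ⊕ L²`; the second component is determined by the first. -/
abbrev H1 : Submodule ℂ (WithLp 2 (L2 × L2)) where
  carrier := {w | IsWeakDeriv w.fst w.snd}
  add_mem' := by
    intro a b ha hb
    simp only [mem_ofPred_eq, IsWeakDeriv, ← Lp.toTemperedDistributionCLM_apply] at *
    rw [WithLp.add_fst, WithLp.add_snd, map_add, map_add, lineDerivOp_add, ha, hb]
  zero_mem' := by
    simp only [mem_ofPred_eq, IsWeakDeriv, ← Lp.toTemperedDistributionCLM_apply]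
    simp [map_zero, lineDerivOp_zero]
  smul_mem' := by
    intro c a ha
    simp only [mem_ofPred_eq, IsWeakDeriv, ← Lp.toTemperedDistributionCLM_apply] at *
    rw [WithLp.smul_fst, WithLp.smul_snd, map_smul, map_smul, lineDerivOp_smul, ha]

/-- The `L²` function underlying an element of `H¹(ℝ)`. -/
def toL2 (w : H1) : L2 := (w : WithLp 2 (L2 × L2)).fst

/-- `g = |D| f` for `f, g ∈ L²(ℝ)`, where `|D| = (-Δ)^{1/2}`. With the normalization
`𝓕 f ξ = ∫ e^{-2πixξ} f x dx` of the Fourier transform, the symbol of `|D|` is `2π|ξ|`. -/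
def IsAbsD (f g : L2) : Prop :=
  ∀ᵐ ξ : ℝ, (𝓕 g : L2) ξ = ((2 * Real.pi * |ξ| : ℝ) : ℂ) * (𝓕 f : L2) ξ

/-- `g = |f|^{p-1} f` for `f, g ∈ L²(ℝ)`. -/
def IsPowerNonlinearity (p : ℝ) (f g : L2) : Prop :=
  ∀ᵐ x : ℝ, g x = ((‖f x‖ ^ (p - 1) : ℝ) : ℂ) * f x

/-- The time interval `[0, T)` for `T ∈ [0, ∞]`. -/
def timeInterval (T : ℝ≥0∞) : Set ℝ := {t | 0 ≤ t ∧ ENNReal.ofReal t < T}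

/-- `u` is an `H¹(ℝ)` solution on `[0, T)` of `∂ₜ u = -i|D|u + |u|^{p-1}u`, `u(0) = u₀`:
`u ∈ C([0, T); H¹(ℝ))`, and at each `t ∈ [0, T)` both `|D|u(t)` and `|u(t)|^{p-1}u(t)` lie in
`L²(ℝ)` and the equation holds in `L²(ℝ)`, with a one-sided derivative at `t = 0`.
The values of `u` outside `[0, T)` are irrelevant. -/
structure IsH1Solution (p : ℝ) (u₀ : H1) (T : ℝ≥0∞) (u : ℝ → H1) : Prop where
  initial : u 0 = u₀
  continuousOn : ContinuousOn u (timeInterval T)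
  equation : ∀ t ∈ timeInterval T, ∃ a b : L2,
    IsAbsD (toL2 (u t)) a ∧ IsPowerNonlinearity p (toL2 (u t)) b ∧
      HasDerivWithinAt (fun s => toL2 (u s)) (-Complex.I • a + b) (timeInterval T) t

/-- `u` is an `H¹(ℝ)` solution whose lifespan (maximal existence time) is `T ∈ (0, ∞]`: it solves
the problem on `[0, T)` and does not extend to an `H¹(ℝ)` solution on a longer interval. -/
structure IsH1SolutionWithLifespan (p : ℝ) (u₀ : H1) (T : ℝ≥0∞) (u : ℝ → H1) : Prop where
  pos : 0 < T
  solution : IsH1Solution p u₀ T u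
  maximal : ∀ (T' : ℝ≥0∞) (v : ℝ → H1), T < T' → IsH1Solution p u₀ T' v →
    ¬ EqOn v u (timeInterval T)

end FractionalGL

end

noncomputable section

namespace FractionalGL

open Filter Topology

/-! ### Convergence in `L²` and Fourier multipliers -/

/-! Write N(w) = |w|^{p-1} w. For w(t) = e^{it|D|} u(t) the equation becomes w' = e^{it|D|}
N(e^{-it|D|} w), and the group acts isometrically on `L2` and on `H1`, so only N has to be
estimated. Since ‖w‖_∞ ≤ 2‖w‖ on `H1`, N maps the ball of radius M into the ball of radius K M with
K = 2p(2M)^{p-1}. Picard iteration from data of norm at most M/2 therefore stays in the ball for a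
time 1/(2K). With M proportional to R this time is a constant times R^{-(p-1)}, and Zorn's lemma
extends the local solution to a maximal one.

The difficulty is convergence of the iteration: for p < 2 the derivative of z ↦ |z|^{p-1} z is only
Hölder continuous, so N need not be locally Lipschitz on `H1`. Two weaker facts replace this. On
bounded sets of `H1`, N is Lipschitz for the L² norm (`norm_toL2_powerH1_sub_le`), and it is
Lipschitz for the `H1` norm up to an arbitrarily small error once the arguments are close in L²
(`exists_norm_powerH1_sub_le`). The iterates are thus Cauchy first in L², then in `H1`
(`exists_hasDerivWithinAt_of_quasiLipschitz`).

That N preserves `H1` comes from viewing the weak derivative as the generator of translations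
(`isWeakDeriv_iff_hasDerivAt`): N commutes with translations, so the chain rule reduces to a
pointwise Taylor estimate. -/

theorem norm_sq_eq_integral (f : L2) : ‖f‖ ^ 2 = ∫ x, ‖f x‖ ^ 2 := by
  have h := inner_self_eq_norm_sq_to_K (𝕜 := ℂ) f
  rw [L2.inner_def] at h
  have h2 : ∀ x, inner ℂ (f x) (f x) = ((‖f x‖ ^ 2 : ℝ) : ℂ) := fun x => by
    rw [inner_self_eq_norm_sq_to_K]; simp
  simp only [h2, integral_complex_ofReal] at h
  have h3 : ((‖f‖ ^ 2 : ℝ) : ℂ) = ((∫ x, ‖f x‖ ^ 2 : ℝ) : ℂ) := by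
    rw [h]; simp
  exact Complex.ofReal_injective h3

theorem integrable_norm_sq (f : L2) : Integrable fun x => ‖f x‖ ^ 2 :=
  (memLp_two_iff_integrable_sq_norm (Lp.aestronglyMeasurable f)).1 (Lp.memLp f)

/-- Dominated convergence in `L²` for products with a fixed function. -/
theorem tendsto_zero_of_ae_eq_mul {ι : Type*} {l : Filter ι} [l.IsCountablyGenerated]
    {F : ι → L2} {m : ι → ℝ → ℂ} {b : L2} {C : ℝ}
    (hF : ∀ᶠ i in l, ∀ᵐ x, F i x = m i x * b x) (hm : ∀ᶠ i in l, ∀ x, ‖m i x‖ ≤ C)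
    (hlim : ∀ x, Tendsto (fun i => m i x) l (𝓝 0)) : Tendsto F l (𝓝 0) := by
  have key : Tendsto (fun i => ∫ x, ‖F i x‖ ^ 2) l (𝓝 (∫ _x : ℝ, (0 : ℝ))) := by
    have h1 : Tendsto (fun i => ∫ x, ‖m i x * b x‖ ^ 2) l (𝓝 (∫ _x : ℝ, (0 : ℝ))) := by
      apply tendsto_integral_filter_of_dominated_convergence (fun x => C ^ 2 * ‖b x‖ ^ 2)
      · filter_upwards [hF] with i hi
        have : AEStronglyMeasurable (fun x => ‖F i x‖ ^ 2) volume :=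
          (integrable_norm_sq (F i)).aestronglyMeasurable
        refine this.congr ?_
        filter_upwards [hi] with x hx
        rw [hx]
      · filter_upwards [hm] with i hi
        refine Eventually.of_forall fun x => ?_
        rw [norm_mul, mul_pow, Real.norm_of_nonneg (by positivity)]
        gcongr
        exact hi x
      · exact (integrable_norm_sq b).const_mul _
      · refine Eventually.of_forall fun x => ?_
        have := (((hlim x).mul_const (b x)).norm).pow 2
        simpa using this
    refine h1.congr' ?_
    filter_upwards [hF] with i hi
    refine integral_congr_ae ?_
    filter_upwards [hi] with x hx
    rw [hx]
  rw [tendsto_zero_iff_norm_tendsto_zero]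
  have h2 : Tendsto (fun i => √(‖F i‖ ^ 2)) l (𝓝 (√0)) := by
    refine (Real.continuous_sqrt.tendsto 0).comp ?_
    simpa [norm_sq_eq_integral] using key
  simpa using h2

theorem memLp_mul {m : ℝ → ℂ} (hm : Measurable m) (hb : ∀ ξ, ‖m ξ‖ ≤ 1) (f : L2) :
    MemLp (fun ξ => m ξ * f ξ) 2 volume :=
  (Lp.memLp f).of_le (hm.aestronglyMeasurable.mul (Lp.aestronglyMeasurable f))
    (Eventually.of_forall fun ξ => by
      rw [norm_mul]; exact mul_le_of_le_one_left (norm_nonneg _) (hb ξ))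

/-- Multiplication of `L²` functions by a measurable function bounded by one. -/
def mulCLM (m : ℝ → ℂ) (hm : Measurable m) (hb : ∀ ξ, ‖m ξ‖ ≤ 1) : L2 →L[ℂ] L2 :=
  LinearMap.mkContinuous
    { toFun := fun f => MemLp.toLp _ (memLp_mul hm hb f)
      map_add' := fun f g => by
        ext1
        filter_upwards [MemLp.coeFn_toLp (memLp_mul hm hb (f + g)), MemLp.coeFn_toLp (memLp_mul hm hb f),
          MemLp.coeFn_toLp (memLp_mul hm hb g), Lp.coeFn_add f g,
          Lp.coeFn_add (MemLp.toLp _ (memLp_mul hm hb f)) (MemLp.toLp _ (memLp_mul hm hb g))] with x h1 h2 h3 h4 h5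
        rw [h1, h5, Pi.add_apply, h2, h3, h4, Pi.add_apply, mul_add]
      map_smul' := fun c f => by
        ext1
        filter_upwards [MemLp.coeFn_toLp (memLp_mul hm hb (c • f)), MemLp.coeFn_toLp (memLp_mul hm hb f),
          Lp.coeFn_smul c f, Lp.coeFn_smul c (MemLp.toLp _ (memLp_mul hm hb f))] with x h1 h2 h3 h4
        rw [h1, RingHom.id_apply, h4, Pi.smul_apply, h2, h3, Pi.smul_apply, smul_eq_mul,
          smul_eq_mul]
        ring } 1
    (fun f => by
      refine Lp.norm_le_mul_norm_of_ae_le_mul ?_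
      filter_upwards [MemLp.coeFn_toLp (memLp_mul hm hb f)] with x hx
      change ‖(MemLp.toLp _ (memLp_mul hm hb f)) x‖ ≤ _
      rw [hx, norm_mul]
      gcongr
      exact hb x)

theorem mulCLM_coeFn (m : ℝ → ℂ) (hm : Measurable m) (hb : ∀ ξ, ‖m ξ‖ ≤ 1) (f : L2) :
    ∀ᵐ ξ, mulCLM m hm hb f ξ = m ξ * f ξ :=
  MemLp.coeFn_toLp (memLp_mul hm hb f)

/-- The Fourier multiplier with a measurable symbol bounded by one. -/
def fourierMul (m : ℝ → ℂ) (hm : Measurable m) (hb : ∀ ξ, ‖m ξ‖ ≤ 1) : L2 →L[ℂ] L2 :=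
  ((Lp.fourierTransformₗᵢ ℝ ℂ).symm : L2 →L[ℂ] L2) ∘L mulCLM m hm hb ∘L
    ((Lp.fourierTransformₗᵢ ℝ ℂ) : L2 →L[ℂ] L2)

theorem fourier_fourierMul (m : ℝ → ℂ) (hm : Measurable m) (hb : ∀ ξ, ‖m ξ‖ ≤ 1) (f : L2) :
    ∀ᵐ ξ, (𝓕 (fourierMul m hm hb f) : L2) ξ = m ξ * (𝓕 f : L2) ξ := by
  have : (𝓕 (fourierMul m hm hb f) : L2) = mulCLM m hm hb (𝓕 f) :=
    (Lp.fourierTransformₗᵢ ℝ ℂ).apply_symm_apply _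
  rw [this]
  exact mulCLM_coeFn m hm hb _

theorem norm_fourierMul_le (m : ℝ → ℂ) (hm : Measurable m) (hb : ∀ ξ, ‖m ξ‖ ≤ 1) (f : L2) :
    ‖fourierMul m hm hb f‖ ≤ ‖f‖ := by
  rw [← Lp.norm_fourier_eq, ← Lp.norm_fourier_eq f, ← one_mul ‖(𝓕 f : L2)‖]
  refine Lp.norm_le_mul_norm_of_ae_le_mul ?_
  filter_upwards [fourier_fourierMul m hm hb f] with ξ h
  rw [h, norm_mul]
  gcongr
  exact hb ξ

theorem fourier_ext {f g : L2} (h : ∀ᵐ ξ, (𝓕 f : L2) ξ = (𝓕 g : L2) ξ) : f = g :=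
  (Lp.fourierTransformₗᵢ ℝ ℂ).injective (Lp.ext h)

theorem fourier_sub_coeFn (f g : L2) :
    ∀ᵐ ξ, (𝓕 (f - g) : L2) ξ = (𝓕 f : L2) ξ - (𝓕 g : L2) ξ := by
  have : (𝓕 (f - g) : L2) = 𝓕 f - 𝓕 g := (Lp.fourierTransformₗᵢ ℝ ℂ).map_sub f g
  rw [this]
  exact Lp.coeFn_sub _ _

theorem fourier_smul_coeFn (c : ℂ) (f : L2) :
    ∀ᵐ ξ, (𝓕 (c • f) : L2) ξ = c * (𝓕 f : L2) ξ := by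
  have : (𝓕 (c • f) : L2) = c • 𝓕 f := (Lp.fourierTransformₗᵢ ℝ ℂ).map_smul c f
  rw [this]
  exact Lp.coeFn_smul _ _

theorem tendsto_zero_of_fourier {ι : Type*} {l : Filter ι} {F : ι → L2}
    (h : Tendsto (fun i => (𝓕 (F i) : L2)) l (𝓝 0)) : Tendsto F l (𝓝 0) := by
  rw [tendsto_zero_iff_norm_tendsto_zero] at h ⊢
  simpa using h

/-! ### The unitary group generated by a real Fourier symbol -/

/-- The unitary group `exp(i t a(D))` on `L²`. -/
def unitaryGroup (a : C(ℝ, ℝ)) (t : ℝ) : L2 →L[ℂ] L2 :=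
  fourierMul (fun ξ => Complex.exp ((t * a ξ : ℝ) * Complex.I))
    (by have := a.continuous; exact Continuous.measurable (by fun_prop))
    (fun ξ => (Complex.norm_exp_ofReal_mul_I _).le)

theorem fourier_unitaryGroup (a : C(ℝ, ℝ)) (t : ℝ) (f : L2) :
    ∀ᵐ ξ, (𝓕 (unitaryGroup a t f) : L2) ξ =
      Complex.exp ((t * a ξ : ℝ) * Complex.I) * (𝓕 f : L2) ξ :=
  fourier_fourierMul _ _ _ f

theorem unitaryGroup_zero (a : C(ℝ, ℝ)) (f : L2) : unitaryGroup a 0 f = f := by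
  apply fourier_ext
  filter_upwards [fourier_unitaryGroup a 0 f] with ξ h
  simp [h]

theorem unitaryGroup_add (a : C(ℝ, ℝ)) (s t : ℝ) (f : L2) :
    unitaryGroup a (s + t) f = unitaryGroup a s (unitaryGroup a t f) := by
  apply fourier_ext
  filter_upwards [fourier_unitaryGroup a (s + t) f, fourier_unitaryGroup a t f,
    fourier_unitaryGroup a s (unitaryGroup a t f)] with ξ h1 h2 h3
  rw [h1, h3, h2, ← mul_assoc, ← Complex.exp_add]
  congr 2
  push_cast
  ring

theorem norm_unitaryGroup (a : C(ℝ, ℝ)) (t : ℝ) (f : L2) : ‖unitaryGroup a t f‖ = ‖f‖ := by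
  refine le_antisymm (norm_fourierMul_le _ _ _ _) ?_
  have : f = unitaryGroup a (-t) (unitaryGroup a t f) := by
    rw [← unitaryGroup_add]; simp [unitaryGroup_zero]
  conv_lhs => rw [this]
  exact norm_fourierMul_le _ _ _ _

theorem tendsto_unitaryGroup_zero (a : C(ℝ, ℝ)) (f : L2) :
    Tendsto (fun t => unitaryGroup a t f) (𝓝 0) (𝓝 f) := by
  rw [← tendsto_sub_nhds_zero_iff]
  apply tendsto_zero_of_fourier
  refine tendsto_zero_of_ae_eq_mul (b := 𝓕 f) (C := 2)
    (m := fun t ξ => Complex.exp ((t * a ξ : ℝ) * Complex.I) - 1) (Eventually.of_forall fun t => ?_)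
    (Eventually.of_forall fun t ξ => ?_) fun ξ => ?_
  · filter_upwards [fourier_unitaryGroup a t f, fourier_sub_coeFn (unitaryGroup a t f) f]
      with ξ h1 h2
    rw [h2, h1]; ring
  · refine (norm_sub_le _ _).trans ?_
    rw [Complex.norm_exp_ofReal_mul_I]; norm_num
  · have : Continuous fun t : ℝ => Complex.exp ((t * a ξ : ℝ) * Complex.I) - 1 := by fun_prop
    simpa using this.tendsto 0

theorem continuous_unitaryGroup (a : C(ℝ, ℝ)) (f : L2) :
    Continuous fun t => unitaryGroup a t f := by
  rw [continuous_iff_continuousAt]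
  intro t
  have h : (fun s => unitaryGroup a s f) = fun s => unitaryGroup a (s - t) (unitaryGroup a t f) := by
    ext1 s; rw [← unitaryGroup_add]; simp
  rw [h]
  have h2 : Tendsto (fun s : ℝ => s - t) (𝓝 t) (𝓝 0) := by
    have : Continuous fun s : ℝ => s - t := by fun_prop
    simpa using this.tendsto t
  have h3 := (tendsto_unitaryGroup_zero a (unitaryGroup a t f)).comp h2
  rw [ContinuousAt, sub_self, unitaryGroup_zero]
  exact h3

theorem slope_unitaryGroup_coeFn (a : C(ℝ, ℝ)) (f : L2) (t : ℝ) :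
    ∀ᵐ ξ, (𝓕 (slope (fun t => unitaryGroup a t f) 0 t) : L2) ξ =
      (t : ℂ)⁻¹ * (Complex.exp ((t * a ξ : ℝ) * Complex.I) - 1) * (𝓕 f : L2) ξ := by
  have h0 : slope (fun t => unitaryGroup a t f) 0 t = (t : ℂ)⁻¹ • (unitaryGroup a t f - f) := by
    rw [slope_def_module, unitaryGroup_zero, sub_zero, ← Complex.ofReal_inv]
    exact (Complex.coe_smul _ _).symm
  rw [h0]
  filter_upwards [fourier_unitaryGroup a t f, fourier_sub_coeFn (unitaryGroup a t f) f,
    fourier_smul_coeFn (t : ℂ)⁻¹ (unitaryGroup a t f - f)] with ξ h1 h2 h3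
  rw [h3, h2, h1]; ring

theorem tendsto_slope_exp (b : ℝ) :
    Tendsto (fun t : ℝ => (t : ℂ)⁻¹ * (Complex.exp ((t * b : ℝ) * Complex.I) - 1)) (𝓝[≠] 0)
      (𝓝 (Complex.I * b)) := by
  have h : HasDerivAt (fun t : ℝ => Complex.exp ((t * b : ℝ) * Complex.I)) (Complex.I * b) 0 := by
    have h1 : HasDerivAt (fun t : ℝ => ((t * b : ℝ) : ℂ) * Complex.I) (((1 * b : ℝ) : ℂ) * Complex.I) 0 :=
      (((hasDerivAt_id (0 : ℝ)).mul_const b).ofReal_comp).mul_const Complex.I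
    have h2 := h1.cexp
    simpa [mul_comm] using h2
  have h3 := hasDerivAt_iff_tendsto_slope.1 h
  refine h3.congr fun t => ?_
  rw [slope_def_module, sub_zero, zero_mul, Complex.ofReal_zero, zero_mul, Complex.exp_zero,
    ← Complex.coe_smul, smul_eq_mul, Complex.ofReal_inv]

/-- Differentiability of the group at elements of the domain of the generator. -/
theorem hasDerivAt_unitaryGroup_zero {a : C(ℝ, ℝ)} {f g : L2}
    (h : ∀ᵐ ξ, (𝓕 g : L2) ξ = Complex.I * a ξ * (𝓕 f : L2) ξ) :
    HasDerivAt (fun t => unitaryGroup a t f) g 0 := by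
  rw [hasDerivAt_iff_tendsto_slope, ← tendsto_sub_nhds_zero_iff]
  apply tendsto_zero_of_fourier
  -- The dominating function is 𝓕 g rather than 𝓕 f: the quotient (e^{ita} - 1)/(ita) is bounded by
  -- 1 uniformly in ξ, even for unbounded a. Where a = 0 the hypothesis forces 𝓕 g = 0, so the
  -- multiplier may be set to 0 there.
  refine tendsto_zero_of_ae_eq_mul (b := 𝓕 g) (C := 2)
    (m := fun t ξ => if a ξ = 0 then 0 else
      (t : ℂ)⁻¹ * (Complex.exp ((t * a ξ : ℝ) * Complex.I) - 1) / (Complex.I * a ξ) - 1)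
    ?_ ?_ fun ξ => ?_
  · refine Eventually.of_forall fun t => ?_
    filter_upwards [h, slope_unitaryGroup_coeFn a f t,
      fourier_sub_coeFn (slope (fun t => unitaryGroup a t f) 0 t) g] with ξ h1 h2 h3
    rw [h3, h2, h1]
    split_ifs with h0
    · simp [h0]
    · have : (a ξ : ℂ) ≠ 0 := by exact_mod_cast h0
      field_simp [Complex.I_ne_zero]
  · filter_upwards [self_mem_nhdsWithin] with t ht ξ
    split_ifs with h0
    · simp
    · have ht : (0 : ℝ) < |t| := abs_pos.2 ht
      have h0 : (0 : ℝ) < |a ξ| := abs_pos.2 h0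
      refine (norm_sub_le _ _).trans ?_
      have h1 : ‖Complex.exp ((t * a ξ : ℝ) * Complex.I) - 1‖ ≤ |t * a ξ| := by
        rw [mul_comm]
        exact Real.norm_exp_I_mul_ofReal_sub_one_le
      have h2 : ‖(t : ℂ)⁻¹ * (Complex.exp ((t * a ξ : ℝ) * Complex.I) - 1) / (Complex.I * a ξ)‖
          ≤ 1 := by
        rw [norm_div, norm_mul, norm_mul, norm_inv, Complex.norm_I, Complex.norm_real,
          Complex.norm_real, one_mul, Real.norm_eq_abs, Real.norm_eq_abs, div_le_one h0,
          inv_mul_le_iff₀ ht, ← abs_mul]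
        exact h1
      rw [norm_one]
      linarith
  · split_ifs with h0
    · exact tendsto_const_nhds
    · have hne : Complex.I * a ξ ≠ 0 :=
        mul_ne_zero Complex.I_ne_zero (by exact_mod_cast h0)
      have h1 := ((tendsto_slope_exp (a ξ)).div_const (Complex.I * a ξ)).sub_const 1
      rwa [div_self hne, sub_self] at h1

/-- L² convergence of the difference quotients gives almost everywhere convergence of their Fourier
transforms along a subsequence of times, and the pointwise limit is explicit. -/
theorem fourier_eq_of_hasDerivAt_unitaryGroup {a : C(ℝ, ℝ)} {f g : L2}
    (h : HasDerivAt (fun t => unitaryGroup a t f) g 0) :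
    ∀ᵐ ξ, (𝓕 g : L2) ξ = Complex.I * a ξ * (𝓕 f : L2) ξ := by
  let t : ℕ → ℝ := fun n => 1 / ((n : ℝ) + 1)
  have ht0 : Tendsto t atTop (𝓝[≠] 0) :=
    tendsto_nhdsWithin_iff.2 ⟨tendsto_one_div_add_atTop_nhds_zero_nat,
      Eventually.of_forall fun n => (Nat.one_div_pos_of_nat (α := ℝ) (n := n)).ne'⟩
  have h1 : Tendsto (fun n => (𝓕 (slope (fun t => unitaryGroup a t f) 0 (t n)) : L2)) atTop
      (𝓝 (𝓕 g)) :=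
    ((Lp.fourierTransformₗᵢ ℝ ℂ).continuous.tendsto g).comp
      ((hasDerivAt_iff_tendsto_slope.1 h).comp ht0)
  obtain ⟨ns, hns, hae⟩ := (tendstoInMeasure_of_tendsto_Lp h1).exists_seq_tendsto_ae
  have h2 : ∀ᵐ ξ, ∀ n, (𝓕 (slope (fun t => unitaryGroup a t f) 0 (t n)) : L2) ξ =
      ((t n : ℝ) : ℂ)⁻¹ * (Complex.exp ((t n * a ξ : ℝ) * Complex.I) - 1) * (𝓕 f : L2) ξ :=
    ae_all_iff.2 fun n => slope_unitaryGroup_coeFn a f (t n)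
  filter_upwards [hae, h2] with ξ h3 h4
  refine tendsto_nhds_unique h3 ?_
  have h5 := (((tendsto_slope_exp (a ξ)).comp (ht0.comp hns.tendsto_atTop)).mul_const
    ((𝓕 f : L2) ξ))
  refine h5.congr fun n => ?_
  rw [h4]
  rfl

/-- The symbol `2πξ`, whose group consists of the translations. -/
def translationSymbol : C(ℝ, ℝ) := ⟨fun ξ => 2 * Real.pi * ξ, by fun_prop⟩

/-- The symbol `-2π|ξ|`, that is, minus the symbol of `|D|`. -/
def absSymbol : C(ℝ, ℝ) := ⟨fun ξ => -(2 * Real.pi * |ξ|), by fun_prop⟩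

theorem unitaryGroup_translation_schwartz (h : ℝ) (φ : 𝓢(ℝ, ℂ)) :
    unitaryGroup translationSymbol h (φ.toLp 2) =
      Lp.compMeasurePreserving (fun x => x + h) (measurePreserving_add_right volume h)
        (φ.toLp 2) := by
  have hm := measurePreserving_add_right (volume : Measure ℝ) h
  obtain ⟨ψ, hψ⟩ : ∃ ψ : 𝓢(ℝ, ℂ), ∀ x, ψ x = φ (x + h) := by
    refine ⟨SchwartzMap.compSubConstCLM ℂ (-h) φ, fun x => ?_⟩
    simp
  have h1 : Lp.compMeasurePreserving (fun x => x + h) hm (φ.toLp 2) = ψ.toLp 2 := by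
    ext1
    filter_upwards [Lp.coeFn_compMeasurePreserving (φ.toLp 2 volume) hm,
      ψ.coeFn_toLp 2 volume, hm.quasiMeasurePreserving.ae (φ.coeFn_toLp 2 volume)] with x h1 h2 h3
    rw [h1, h2, hψ, Function.comp_apply, h3]
  rw [h1]
  apply fourier_ext
  rw [SchwartzMap.toLp_fourier_eq]
  filter_upwards [fourier_unitaryGroup translationSymbol h (φ.toLp 2),
    (𝓕 φ).coeFn_toLp 2 volume, (𝓕 ψ).coeFn_toLp 2 volume] with ξ h2 h3 h4
  rw [h2, h4, SchwartzMap.toLp_fourier_eq, h3]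
  have h5 : ⇑ψ = ⇑φ ∘ fun v => v + h := funext hψ
  rw [SchwartzMap.fourier_coe, SchwartzMap.fourier_coe, h5]
  rw [Real.fourier_real_eq_integral_exp_smul, Real.fourier_real_eq_integral_exp_smul,
    ← integral_const_mul, ← integral_add_right_eq_self _ h]
  congr 1 with v
  rw [Function.comp_apply, smul_eq_mul, smul_eq_mul, ← mul_assoc, ← Complex.exp_add]
  congr 2
  simp only [translationSymbol, ContinuousMap.coe_mk]
  push_cast
  ring

theorem unitaryGroup_translation (h : ℝ) (f : L2) :
    unitaryGroup translationSymbol h f =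
      Lp.compMeasurePreserving (fun x => x + h) (measurePreserving_add_right volume h) f := by
  refine DenseRange.induction_on
    (SchwartzMap.denseRange_toLpCLM (E := ℝ) (F := ℂ) (p := 2) (μ := volume) ENNReal.ofNat_ne_top)
    f (isClosed_eq (unitaryGroup translationSymbol h).continuous
      (Lp.isometry_compMeasurePreserving _).continuous)
    fun φ => unitaryGroup_translation_schwartz h φ

theorem unitaryGroup_translation_coeFn (h : ℝ) (f : L2) :
    ∀ᵐ x, unitaryGroup translationSymbol h f x = f (x + h) := by
  rw [unitaryGroup_translation]
  exact Lp.coeFn_compMeasurePreserving f _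

/-! ### Weak derivatives on the Fourier side -/

/-- The Fourier transform is injective on tempered distributions and turns the derivative into
multiplication by 2πiξ. Testing against compactly supported smooth functions needs only local
integrability of ξ 𝓕 f, so the growth of the symbol is harmless. -/
theorem isWeakDeriv_iff_fourier (f g : L2) :
    IsWeakDeriv f g ↔ ∀ᵐ ξ, (𝓕 g : L2) ξ = Complex.I * translationSymbol ξ * (𝓕 f : L2) ξ := by
  have hinj : IsWeakDeriv f g ↔
      𝓕 (∂_{(1 : ℝ)} (f : 𝓢'(ℝ, ℂ))) = 𝓕 (g : 𝓢'(ℝ, ℂ)) :=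
    ⟨fun h => congrArg _ h, fun h => by
      have := congrArg (fun T : 𝓢'(ℝ, ℂ) => 𝓕⁻ T) h
      rwa [fourierInv_fourier_eq, fourierInv_fourier_eq] at this⟩
  have htemp : (fun x : ℝ => ((inner ℝ x (1 : ℝ) : ℝ) : ℂ)).HasTemperateGrowth := by fun_prop
  have hdist : 𝓕 (∂_{(1 : ℝ)} (f : 𝓢'(ℝ, ℂ))) = 𝓕 (g : 𝓢'(ℝ, ℂ)) ↔ ∀ φ : 𝓢(ℝ, ℂ),
      ∫ ξ, φ ξ * (Complex.I * translationSymbol ξ * (𝓕 f : L2) ξ) =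
        ∫ ξ, φ ξ * (𝓕 g : L2) ξ := by
    rw [TemperedDistribution.fourier_lineDerivOp_eq, Lp.fourier_toTemperedDistribution_eq,
      Lp.fourier_toTemperedDistribution_eq]
    have : ∀ T S : 𝓢'(ℝ, ℂ), T = S ↔ ∀ φ, T φ = S φ := fun T S =>
      ⟨fun h φ => by rw [h], fun h => by ext φ; exact h φ⟩
    rw [this]
    refine forall_congr' fun φ => ?_
    have e1 : ((2 * Real.pi * Complex.I) • TemperedDistribution.smulLeftCLM ℂ
        (fun x : ℝ => ((inner ℝ x (1 : ℝ) : ℝ) : ℂ)) ((𝓕 f : L2) : 𝓢'(ℝ, ℂ))) φ =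
        ∫ ξ, φ ξ * (Complex.I * translationSymbol ξ * (𝓕 f : L2) ξ) := by
      change (2 * Real.pi * Complex.I) • (Lp.toTemperedDistribution (𝓕 f : L2)
        (SchwartzMap.smulLeftCLM ℂ (fun x : ℝ => ((inner ℝ x (1 : ℝ) : ℝ) : ℂ)) φ)) = _
      rw [Lp.toTemperedDistribution_apply, smul_eq_mul, ← integral_const_mul]
      congr 1 with ξ
      rw [SchwartzMap.smulLeftCLM_apply_apply htemp]
      simp [translationSymbol]
      ring
    have e2 : ((𝓕 g : L2) : 𝓢'(ℝ, ℂ)) φ = ∫ ξ, φ ξ * (𝓕 g : L2) ξ := by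
      rw [Lp.toTemperedDistribution_apply]; simp
    rw [e1, e2]
  rw [hinj, hdist]
  constructor
  · intro h
    refine (ae_eq_of_integral_contDiff_smul_eq ?_ ?_ fun φ hφ hc => ?_)
    · exact (Lp.memLp (𝓕 g : L2)).locallyIntegrable (by norm_num)
    · refine LocallyIntegrable.continuous_mul ?_
        ((Lp.memLp (𝓕 f : L2)).locallyIntegrable (by norm_num))
      have := translationSymbol.continuous
      fun_prop
    · have hg₁ : HasCompactSupport (Complex.ofRealCLM ∘ φ) := hc.comp_left rfl
      have hg₂ : ContDiff ℝ (⊤ : ℕ∞) (Complex.ofRealCLM ∘ φ) :=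
        Complex.ofRealCLM.contDiff.comp hφ
      have := h (hg₁.toSchwartzMap hg₂)
      simpa using this.symm
  · intro h φ
    refine integral_congr_ae ?_
    filter_upwards [h] with ξ hξ
    rw [hξ]

theorem isWeakDeriv_iff_hasDerivAt (f g : L2) :
    IsWeakDeriv f g ↔ HasDerivAt (fun t => unitaryGroup translationSymbol t f) g 0 := by
  rw [isWeakDeriv_iff_fourier]
  exact ⟨hasDerivAt_unitaryGroup_zero, fourier_eq_of_hasDerivAt_unitaryGroup⟩

/-! ### The space `H¹` -/

/-- The weak derivative of an element of `H¹(ℝ)`. -/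
def weakDeriv (w : H1) : L2 := (w : WithLp 2 (L2 × L2)).snd

theorem isWeakDeriv_weakDeriv (w : H1) : IsWeakDeriv (toL2 w) (weakDeriv w) := w.2

/-- The element of `H¹(ℝ)` with a given function and weak derivative. -/
def mkH1 (f g : L2) (h : IsWeakDeriv f g) : H1 := ⟨WithLp.toLp 2 (f, g), h⟩

@[simp] theorem toL2_mkH1 (f g : L2) (h : IsWeakDeriv f g) : toL2 (mkH1 f g h) = f := rfl

@[simp] theorem weakDeriv_mkH1 (f g : L2) (h : IsWeakDeriv f g) : weakDeriv (mkH1 f g h) = g := rfl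

theorem H1_ext {v w : H1} (h1 : toL2 v = toL2 w) (h2 : weakDeriv v = weakDeriv w) : v = w :=
  Subtype.ext (WithLp.ofLp_injective 2 (Prod.ext h1 h2))

theorem toL2_sub (v w : H1) : toL2 (v - w) = toL2 v - toL2 w := rfl

theorem weakDeriv_sub (v w : H1) : weakDeriv (v - w) = weakDeriv v - weakDeriv w := rfl

theorem norm_sq_H1 (w : H1) : ‖w‖ ^ 2 = ‖toL2 w‖ ^ 2 + ‖weakDeriv w‖ ^ 2 :=
  WithLp.prod_norm_sq_eq_of_L2 (w : WithLp 2 (L2 × L2))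

theorem norm_toL2_le (w : H1) : ‖toL2 w‖ ≤ ‖w‖ := by
  have := norm_sq_H1 w
  exact (sq_le_sq₀ (norm_nonneg _) (norm_nonneg _)).1 (by nlinarith [sq_nonneg ‖weakDeriv w‖])

theorem norm_weakDeriv_le (w : H1) : ‖weakDeriv w‖ ≤ ‖w‖ := by
  have := norm_sq_H1 w
  exact (sq_le_sq₀ (norm_nonneg _) (norm_nonneg _)).1 (by nlinarith [sq_nonneg ‖toL2 w‖])

theorem norm_H1_le (w : H1) : ‖w‖ ≤ ‖toL2 w‖ + ‖weakDeriv w‖ := by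
  have := norm_sq_H1 w
  exact (sq_le_sq₀ (norm_nonneg _) (by positivity)).1
    (by nlinarith [mul_nonneg (norm_nonneg (toL2 w)) (norm_nonneg (weakDeriv w))])

/-- The embedding `H¹ → L²` as a continuous linear map. -/
def toL2CLM : H1 →L[ℂ] L2 :=
  LinearMap.mkContinuous { toFun := toL2, map_add' := fun _ _ => rfl, map_smul' := fun _ _ => rfl }
    1 fun w => by rw [one_mul]; exact norm_toL2_le w

@[simp] theorem toL2CLM_apply (w : H1) : toL2CLM w = toL2 w := rfl

/-- Tested against a fixed Schwartz function, both sides of the weak derivative identity are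
continuous for L² convergence. Closedness gives the completeness used in the Picard iteration. -/
theorem isClosed_H1 : IsClosed (H1 : Set (WithLp 2 (L2 × L2))) := by
  have h : (H1 : Set (WithLp 2 (L2 × L2))) = ⋂ φ : 𝓢(ℝ, ℂ), {w |
      (lineDerivOpCLM ℂ 𝓢'(ℝ, ℂ) (1 : ℝ) (Lp.toTemperedDistributionCLM ℂ volume 2 w.fst)) φ =
        (Lp.toTemperedDistributionCLM ℂ volume 2 w.snd) φ} := by
    ext w
    simp only [mem_iInter, mem_ofPred_eq]
    constructor
    · intro h φ
      exact congrArg (fun T : 𝓢'(ℝ, ℂ) => T φ) h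
    · intro h
      change IsWeakDeriv w.fst w.snd
      unfold IsWeakDeriv
      ext φ
      exact h φ
  rw [h]
  refine isClosed_iInter fun φ => ?_
  have hev : Continuous fun T : 𝓢'(ℝ, ℂ) => T φ :=
    (PointwiseConvergenceCLM.evalCLM (RingHom.id ℂ) (E := 𝓢(ℝ, ℂ)) ℂ φ).continuous
  refine isClosed_eq (hev.comp ?_) (hev.comp ?_)
  · exact (lineDerivOpCLM ℂ 𝓢'(ℝ, ℂ) (1 : ℝ)).continuous.comp
      ((Lp.toTemperedDistributionCLM ℂ volume 2).continuous.comp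
        (WithLp.prod_continuous_ofLp 2 L2 L2).fst)
  · exact (Lp.toTemperedDistributionCLM ℂ volume 2).continuous.comp
        (WithLp.prod_continuous_ofLp 2 L2 L2).snd

instance : CompleteSpace H1 := isClosed_H1.completeSpace_coe

theorem isWeakDeriv_unitaryGroup (a : C(ℝ, ℝ)) (t : ℝ) {f g : L2} (h : IsWeakDeriv f g) :
    IsWeakDeriv (unitaryGroup a t f) (unitaryGroup a t g) := by
  rw [isWeakDeriv_iff_fourier] at h ⊢
  filter_upwards [h, fourier_unitaryGroup a t f, fourier_unitaryGroup a t g] with ξ h1 h2 h3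
  rw [h3, h1, h2]; ring

/-- The unitary group `exp(i t a(D))` on `H¹`. -/
def h1Group (a : C(ℝ, ℝ)) (t : ℝ) : H1 →ₗᵢ[ℂ] H1 where
  toFun w := mkH1 _ _ (isWeakDeriv_unitaryGroup a t (isWeakDeriv_weakDeriv w))
  map_add' v w := H1_ext ((unitaryGroup a t).map_add _ _) ((unitaryGroup a t).map_add _ _)
  map_smul' c w := H1_ext ((unitaryGroup a t).map_smul _ _) ((unitaryGroup a t).map_smul _ _)
  norm_map' w := by
    refine (sq_eq_sq₀ (norm_nonneg _) (norm_nonneg _)).1 ?_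
    rw [norm_sq_H1, norm_sq_H1]
    change ‖unitaryGroup a t (toL2 w)‖ ^ 2 + ‖unitaryGroup a t (weakDeriv w)‖ ^ 2 = _
    rw [norm_unitaryGroup, norm_unitaryGroup]

@[simp] theorem toL2_h1Group (a : C(ℝ, ℝ)) (t : ℝ) (w : H1) :
    toL2 (h1Group a t w) = unitaryGroup a t (toL2 w) := rfl

@[simp] theorem weakDeriv_h1Group (a : C(ℝ, ℝ)) (t : ℝ) (w : H1) :
    weakDeriv (h1Group a t w) = unitaryGroup a t (weakDeriv w) := rfl

theorem h1Group_zero (a : C(ℝ, ℝ)) (w : H1) : h1Group a 0 w = w :=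
  H1_ext (unitaryGroup_zero a _) (unitaryGroup_zero a _)

theorem continuous_h1Group (a : C(ℝ, ℝ)) (w : H1) : Continuous fun t => h1Group a t w := by
  refine Continuous.subtype_mk ?_ _
  exact (WithLp.prod_continuous_toLp 2 L2 L2).comp
    ((continuous_unitaryGroup a (toL2 w)).prodMk (continuous_unitaryGroup a (weakDeriv w)))

/-- Strong continuity in time and the isometry property together give joint continuity. -/
theorem continuous_h1Group_uncurry (a : C(ℝ, ℝ)) :
    Continuous fun q : ℝ × H1 => h1Group a q.1 q.2 := by
  rw [continuous_iff_continuousAt]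
  rintro ⟨t, w⟩
  rw [ContinuousAt, tendsto_iff_norm_sub_tendsto_zero]
  have h1 : Tendsto (fun q : ℝ × H1 => ‖q.2 - w‖ + ‖h1Group a q.1 w - h1Group a t w‖) (𝓝 (t, w))
      (𝓝 0) := by
    have : Continuous fun q : ℝ × H1 => ‖q.2 - w‖ + ‖h1Group a q.1 w - h1Group a t w‖ := by
      have := (continuous_h1Group a w).comp (continuous_fst : Continuous (Prod.fst : ℝ × H1 → ℝ))
      exact (continuous_snd.sub continuous_const).norm.add (this.sub continuous_const).norm
    simpa using this.tendsto (t, w)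
  refine squeeze_zero (fun _ => norm_nonneg _) (fun q => ?_) h1
  have : h1Group a q.1 q.2 - h1Group a t w =
      h1Group a q.1 (q.2 - w) + (h1Group a q.1 w - h1Group a t w) := by
    rw [map_sub]; abel
  rw [this]
  refine (norm_add_le _ _).trans ?_
  rw [LinearIsometry.norm_map]

/-! ### The product rule for the group, and `|D|` -/

theorem hasDerivAt_unitaryGroup {a : C(ℝ, ℝ)} {f g : L2}
    (h : ∀ᵐ ξ, (𝓕 g : L2) ξ = Complex.I * a ξ * (𝓕 f : L2) ξ) (t : ℝ) :
    HasDerivAt (fun r => unitaryGroup a r f) (unitaryGroup a t g) t := by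
  have h0 := hasDerivAt_unitaryGroup_zero h
  have h1 : HasDerivAt (fun r => unitaryGroup a (r - t) f) g t := by
    have h2 : HasDerivAt (fun r : ℝ => r - t) 1 t := (hasDerivAt_id t).sub_const t
    have h3 := HasDerivAt.scomp (g₁ := fun r => unitaryGroup a r f) (h := fun r => r - t)
      (g₁' := g) t (by simpa using h0) h2
    rw [one_smul] at h3
    exact h3
  have h4 := ((unitaryGroup a t).restrictScalars ℝ).hasFDerivAt.comp_hasDerivAt t h1
  refine h4.congr_of_eventuallyEq (Eventually.of_forall fun r => ?_)
  simp [← unitaryGroup_add]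

/-- Only v(t) has to lie in the domain of the generator. In v(r) = v(t) + (r - t)v' + o(r - t), the
isometries keep the remainder small, and the linear term needs only strong continuity of the group.
-/
theorem hasDerivWithinAt_unitaryGroup_apply {a : C(ℝ, ℝ)} {v : ℝ → L2} {v' g : L2} {s : Set ℝ}
    {t : ℝ} (hv : HasDerivWithinAt v v' s t)
    (hg : ∀ᵐ ξ, (𝓕 g : L2) ξ = Complex.I * a ξ * (𝓕 (v t) : L2) ξ) :
    HasDerivWithinAt (fun r => unitaryGroup a r (v r)) (unitaryGroup a t (g + v')) s t := by
  have h1 : HasDerivWithinAt (fun r => unitaryGroup a r (v r - v t - (r - t) • v')) 0 s t := by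
    rw [hasDerivWithinAt_iff_isLittleO] at hv ⊢
    refine Asymptotics.IsLittleO.of_norm_left ?_
    refine hv.norm_left.congr_left fun r => ?_
    rw [sub_self (v t), zero_sub, sub_self, zero_smul, neg_zero, map_zero, sub_zero, smul_zero,
      sub_zero, norm_unitaryGroup]
  have h2 : HasDerivWithinAt (fun r => (r - t) • unitaryGroup a r v') (unitaryGroup a t v') s t := by
    refine HasDerivAt.hasDerivWithinAt ?_
    rw [hasDerivAt_iff_tendsto_slope]
    have h3 := ((continuous_unitaryGroup a v').tendsto t).mono_left
      (nhdsWithin_le_nhds (s := {t}ᶜ))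
    refine h3.congr' ?_
    filter_upwards [self_mem_nhdsWithin] with r hr
    have hr : r - t ≠ 0 := sub_ne_zero.2 hr
    rw [slope_def_module, sub_self, zero_smul, sub_zero, smul_smul, inv_mul_cancel₀ hr, one_smul]
  have h4 := (hasDerivAt_unitaryGroup hg t).hasDerivWithinAt (s := s)
  have h5 := (h1.add h2).add h4
  rw [zero_add, ← map_add, add_comm v'] at h5
  refine h5.congr (fun r _ => ?_) ?_
  · have : (r - t) • unitaryGroup a r v' = unitaryGroup a r ((r - t) • v') :=
      (((unitaryGroup a r).restrictScalars ℝ).map_smul (r - t) v').symm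
    simp only [Pi.add_apply, this, ← map_add]
    congr 1; abel
  · simp

theorem measurable_hilbertSymbol : Measurable fun ξ : ℝ => -Complex.I * ((SignType.sign ξ : ℝ) : ℂ) := by
  have h : Measurable fun ξ : ℝ => ((SignType.sign ξ : SignType) : ℝ) := by
    have : (fun ξ : ℝ => ((SignType.sign ξ : SignType) : ℝ)) =
        fun ξ => if 0 < ξ then 1 else if ξ < 0 then -1 else 0 := by
      ext ξ
      rcases lt_trichotomy ξ 0 with h | h | h <;> simp [h, h.le]
    rw [this]
    exact Measurable.ite measurableSet_Ioi measurable_const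
      (Measurable.ite measurableSet_Iio measurable_const measurable_const)
  exact (Complex.measurable_ofReal.comp h).const_mul _

theorem norm_hilbertSymbol_le (ξ : ℝ) : ‖-Complex.I * ((SignType.sign ξ : ℝ) : ℂ)‖ ≤ 1 := by
  rcases lt_trichotomy ξ 0 with h | h | h <;> simp [h]

/-- `|D|` on `H¹`, written as the Hilbert transform of the derivative. -/
def absD (w : H1) : L2 :=
  fourierMul _ measurable_hilbertSymbol norm_hilbertSymbol_le (weakDeriv w)

theorem isAbsD_absD (w : H1) : IsAbsD (toL2 w) (absD w) := by
  filter_upwards [(isWeakDeriv_iff_fourier _ _).1 (isWeakDeriv_weakDeriv w),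
    fourier_fourierMul _ measurable_hilbertSymbol norm_hilbertSymbol_le (weakDeriv w)]
    with ξ h1 h2
  have h3 : ((SignType.sign ξ : ℝ) : ℂ) * (ξ : ℂ) = ((|ξ| : ℝ) : ℂ) := by
    rw [← Complex.ofReal_mul, sign_mul_self]
  rw [absD, h2, h1]
  simp only [translationSymbol, ContinuousMap.coe_mk, Complex.ofReal_mul, ← h3, Complex.ofReal_ofNat]
  linear_combination (-((SignType.sign ξ : ℝ) : ℂ) * 2 * Real.pi * ξ * (𝓕 (toL2 w) : L2) ξ) *
    Complex.I_mul_I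

theorem isAbsD_unitaryGroup (a : C(ℝ, ℝ)) (t : ℝ) {f g : L2} (h : IsAbsD f g) :
    IsAbsD (unitaryGroup a t f) (unitaryGroup a t g) := by
  filter_upwards [h, fourier_unitaryGroup a t f, fourier_unitaryGroup a t g] with ξ h1 h2 h3
  rw [h3, h1, h2]; ring

/-! ### The Sobolev embedding -/

/-- An integrable Fourier transform has a continuous inverse Fourier integral. It equals f almost
everywhere, as moving the transform onto a test function shows, and it is bounded by the L¹ norm of
𝓕 f. -/
theorem ae_norm_le_integral_fourier {f : L2} (hf : Integrable (𝓕 f : L2)) :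
    ∀ᵐ x, ‖f x‖ ≤ ∫ ξ, ‖(𝓕 f : L2) ξ‖ := by
  set F : ℝ → ℂ := ((𝓕 f : L2) : ℝ → ℂ) with hF
  have hcont : Continuous (𝓕⁻ F) :=
    VectorFourier.fourierIntegral_continuous Real.continuous_fourierChar
      (by exact continuous_inner.neg) hf
  have key : ∀ᵐ x, f x = (𝓕⁻ F) x := by
    refine ae_eq_of_integral_contDiff_smul_eq ((Lp.memLp f).locallyIntegrable (by norm_num))
      hcont.locallyIntegrable fun φ hφ hc => ?_
    have hg₁ : HasCompactSupport (Complex.ofRealCLM ∘ φ) := hc.comp_left rfl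
    have hg₂ : ContDiff ℝ (⊤ : ℕ∞) (Complex.ofRealCLM ∘ φ) := Complex.ofRealCLM.contDiff.comp hφ
    set ψ : 𝓢(ℝ, ℂ) := hg₁.toSchwartzMap hg₂
    have h1 : Lp.toTemperedDistribution f ψ = Lp.toTemperedDistribution (𝓕 f : L2) (𝓕⁻ ψ) := by
      have h2 : (f : 𝓢'(ℝ, ℂ)) = 𝓕⁻ ((𝓕 f : L2) : 𝓢'(ℝ, ℂ)) := by
        rw [Lp.fourierInv_toTemperedDistribution_eq, fourierInv_fourier_eq]
      rw [h2]; rfl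
    rw [Lp.toTemperedDistribution_apply, Lp.toTemperedDistribution_apply,
      SchwartzMap.fourierInv_coe] at h1
    have h3 := VectorFourier.integral_fourierIntegral_smul_eq_flip (μ := volume) (ν := volume)
      (L := -innerₗ ℝ) (f := (ψ : ℝ → ℂ)) (g := F) Real.continuous_fourierChar
      (by exact continuous_inner.neg) ψ.integrable hf
    have h4 : (-innerₗ ℝ).flip = -innerₗ ℝ := by
      ext; simp
    rw [h4] at h3
    have h5 := h1.trans h3
    have h6 : VectorFourier.fourierIntegral Real.fourierChar volume (-innerₗ ℝ) F = 𝓕⁻ F := rfl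
    rw [h6] at h5
    simpa [ψ] using h5
  filter_upwards [key] with x hx
  rw [hx]
  exact VectorFourier.norm_fourierIntegral_le_integral_norm _ _ _ _ _

theorem integral_inv_one_add_sq_scaled {A : ℝ} (hA : 0 < A) :
    ∫ ξ : ℝ, (1 + (2 * Real.pi / A * ξ) ^ 2)⁻¹ = A / 2 := by
  have := Measure.integral_comp_mul_left (fun x : ℝ => (1 + x ^ 2)⁻¹) (2 * Real.pi / A)
  rw [integral_univ_inv_one_add_sq] at this
  rw [this, abs_of_pos (by positivity), smul_eq_mul]
  field_simp

/-- Agmon's inequality, in a form with a parameter. -/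
theorem ae_norm_toL2_le (w : H1) {A : ℝ} (hA : 0 < A) :
    ∀ᵐ x, ‖toL2 w x‖ ≤ √A * (‖toL2 w‖ + A⁻¹ * ‖weakDeriv w‖) := by
  -- With k = w + A⁻¹w', 𝓕 w is r times 𝓕 k, where r = 1/(1 + 2πiξ/A) has squared L² norm A/2;
  -- Cauchy–Schwarz then bounds the L¹ norm of 𝓕 w.
  set k : L2 := toL2 w + ((A⁻¹ : ℝ) : ℂ) • weakDeriv w with hk
  set r : ℝ → ℂ := fun ξ => (1 + Complex.I * ((2 * Real.pi / A * ξ : ℝ) : ℂ))⁻¹ with hr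
  have hns : ∀ ξ, ‖r ξ‖ ^ 2 = (1 + (2 * Real.pi / A * ξ) ^ 2)⁻¹ := fun ξ => by
    rw [hr, norm_inv, inv_pow, ← Complex.normSq_eq_norm_sq, mul_comm Complex.I,
      ← Complex.ofReal_one, Complex.normSq_add_mul_I]
    norm_num
  have hrc : Continuous r := by
    refine Continuous.inv₀ (by fun_prop) fun ξ h0 => ?_
    have := hns ξ
    rw [hr] at this
    simp only [h0, inv_zero, norm_zero] at this
    have h2 : 0 < (1 + (2 * Real.pi / A * ξ) ^ 2)⁻¹ := by positivity
    rw [← this] at h2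
    norm_num at h2
  have hint : Integrable fun ξ => ‖r ξ‖ ^ 2 := by
    simp only [hns]
    exact integrable_inv_one_add_sq.comp_mul_left' (by positivity)
  have hr2 : MemLp r 2 := (memLp_two_iff_integrable_sq_norm hrc.aestronglyMeasurable).2 hint
  have hk2 := Lp.memLp (𝓕 k : L2)
  have heq : ∀ᵐ ξ, (𝓕 (toL2 w) : L2) ξ = r ξ * (𝓕 k : L2) ξ := by
    have hadd : (𝓕 k : L2) = 𝓕 (toL2 w) + 𝓕 (((A⁻¹ : ℝ) : ℂ) • weakDeriv w) :=
      (Lp.fourierTransformₗᵢ ℝ ℂ).map_add _ _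
    filter_upwards [(isWeakDeriv_iff_fourier _ _).1 (isWeakDeriv_weakDeriv w),
      fourier_smul_coeFn ((A⁻¹ : ℝ) : ℂ) (weakDeriv w),
      Lp.coeFn_add (𝓕 (toL2 w) : L2) (𝓕 (((A⁻¹ : ℝ) : ℂ) • weakDeriv w))] with ξ h1 h2 h3
    rw [hadd, h3, Pi.add_apply, h2, h1]
    have hne : (1 + Complex.I * ((2 * Real.pi / A * ξ : ℝ) : ℂ)) ≠ 0 := by
      intro h0
      have := congrArg Complex.re h0
      simp at this
    have hr' : r ξ = (1 + Complex.I * ((2 * Real.pi / A * ξ : ℝ) : ℂ))⁻¹ := rfl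
    rw [hr', eq_inv_mul_iff_mul_eq₀ hne]
    simp only [translationSymbol, ContinuousMap.coe_mk]
    push_cast
    ring
  have hi : Integrable (𝓕 (toL2 w) : L2) :=
    (hr2.integrable_mul hk2).congr (by filter_upwards [heq] with ξ h; rw [h]; rfl)
  have hnk : ‖k‖ ≤ ‖toL2 w‖ + A⁻¹ * ‖weakDeriv w‖ := by
    refine (norm_add_le _ _).trans ?_
    rw [norm_smul, Complex.norm_real, Real.norm_of_nonneg (by positivity)]
  have hbound : ∫ ξ, ‖(𝓕 (toL2 w) : L2) ξ‖ ≤ √A * ‖k‖ := by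
    have h1 : ∫ ξ, ‖(𝓕 (toL2 w) : L2) ξ‖ = ∫ ξ, ‖r ξ‖ * ‖(𝓕 k : L2) ξ‖ := by
      refine integral_congr_ae ?_
      filter_upwards [heq] with ξ h
      rw [h, norm_mul]
    have h2 := integral_mul_norm_le_Lp_mul_Lq (μ := volume) (f := r) (g := (𝓕 k : L2))
      Real.HolderConjugate.two_two (by simpa using hr2) (by simpa using hk2)
    have h3 : ∫ ξ, ‖r ξ‖ ^ (2 : ℝ) = A / 2 := by
      rw [← integral_inv_one_add_sq_scaled hA]
      congr 1 with ξ
      rw [← hns ξ, Real.rpow_two]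
    have h4 : ∫ ξ, ‖(𝓕 k : L2) ξ‖ ^ (2 : ℝ) = ‖k‖ ^ 2 := by
      rw [← Lp.norm_fourier_eq k, norm_sq_eq_integral]
      simp only [Real.rpow_two]
    rw [h3, h4, ← Real.sqrt_eq_rpow, ← Real.sqrt_eq_rpow, Real.sqrt_sq (norm_nonneg _)] at h2
    rw [h1]
    refine h2.trans ?_
    gcongr
    linarith
  filter_upwards [ae_norm_le_integral_fourier hi] with x hx
  refine (hx.trans hbound).trans ?_
  gcongr

theorem ae_norm_toL2_le_norm (w : H1) : ∀ᵐ x, ‖toL2 w x‖ ≤ 2 * ‖w‖ := by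
  filter_upwards [ae_norm_toL2_le w one_pos] with x hx
  refine hx.trans ?_
  have := norm_toL2_le w
  have := norm_weakDeriv_le w
  rw [Real.sqrt_one, inv_one, one_mul, one_mul]
  linarith

/-! ### The pointwise nonlinearity `z ↦ |z|^{p-1} z` -/

/-- The map `z ↦ |z|^{p-1} z`. -/
def powerMap (p : ℝ) (z : ℂ) : ℂ := ((‖z‖ ^ (p - 1) : ℝ) : ℂ) * z

/-- The real derivative of `z ↦ |z|^{p-1} z`. -/
def powerMapDeriv (p : ℝ) (z : ℂ) : ℂ →L[ℝ] ℂ :=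
  ‖z‖ ^ (p - 1) • ContinuousLinearMap.id ℝ ℂ +
    ((p - 1) * ‖z‖ ^ (p - 1 - 2)) • (innerSL ℝ z).smulRight z

theorem powerMap_eq_smul (p : ℝ) (z : ℂ) : powerMap p z = ‖z‖ ^ (p - 1) • z :=
  (Complex.real_smul).symm

theorem norm_powerMap (p : ℝ) (z : ℂ) : ‖powerMap p z‖ = ‖z‖ ^ (p - 1) * ‖z‖ := by
  rw [powerMap_eq_smul, norm_smul, Real.norm_of_nonneg (by positivity)]

/-- The factor |z|^{p-3}, singular at 0 for p < 3, always meets |z|², which leaves |z|^{p-1} +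
(p-1)|z|^{p-1}. -/
theorem norm_powerMapDeriv_le {p : ℝ} (hp : 1 < p) (z : ℂ) :
    ‖powerMapDeriv p z‖ ≤ p * ‖z‖ ^ (p - 1) := by
  refine ContinuousLinearMap.opNorm_le_bound _ (by positivity) fun h => ?_
  have h1 : powerMapDeriv p z h =
      ‖z‖ ^ (p - 1) • h + ((p - 1) * ‖z‖ ^ (p - 1 - 2)) • (inner ℝ z h • z) := by
    simp [powerMapDeriv]
  have h2 : ‖z‖ ^ (p - 1 - 2) * (‖z‖ * ‖z‖) ≤ ‖z‖ ^ (p - 1) := by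
    rcases eq_or_ne z 0 with rfl | hz
    · simp [Real.rpow_nonneg]
    · rw [Real.rpow_sub (norm_pos_iff.2 hz), Real.rpow_two]
      have := norm_pos_iff.2 hz
      apply le_of_eq
      field_simp
  rw [h1]
  calc _ ≤ ‖z‖ ^ (p - 1) * ‖h‖ + ((p - 1) * ‖z‖ ^ (p - 1 - 2)) * ((‖z‖ * ‖h‖) * ‖z‖) := by
        refine (norm_add_le _ _).trans ?_
        have hp' : 0 ≤ p - 1 := by linarith
        rw [norm_smul, norm_smul, norm_smul, Real.norm_of_nonneg (by positivity),
          Real.norm_of_nonneg (by positivity)]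
        gcongr
        exact norm_inner_le_norm z h
    _ = ‖z‖ ^ (p - 1) * ‖h‖ + (p - 1) * ‖h‖ * (‖z‖ ^ (p - 1 - 2) * (‖z‖ * ‖z‖)) := by ring
    _ ≤ ‖z‖ ^ (p - 1) * ‖h‖ + (p - 1) * ‖h‖ * ‖z‖ ^ (p - 1) := by
        have hp' : 0 ≤ p - 1 := by linarith
        gcongr
    _ = _ := by ring

theorem powerMap_zero (p : ℝ) : powerMap p 0 = 0 := by simp [powerMap]

theorem tendsto_norm_rpow_zero {q : ℝ} (hq : 0 < q) :
    Tendsto (fun z : ℂ => ‖z‖ ^ q) (𝓝 0) (𝓝 0) := by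
  have : Continuous fun z : ℂ => ‖z‖ ^ q := continuous_norm.rpow_const fun _ => Or.inr hq.le
  simpa [Real.zero_rpow hq.ne'] using this.tendsto 0

theorem powerMapDeriv_zero {p : ℝ} (hp : 1 < p) : powerMapDeriv p 0 = 0 := by
  have : ‖powerMapDeriv p 0‖ ≤ 0 := by
    have := norm_powerMapDeriv_le hp 0
    rwa [norm_zero, Real.zero_rpow (by linarith), mul_zero] at this
  exact norm_le_zero_iff.1 this

theorem hasFDerivAt_powerMap {p : ℝ} (hp : 1 < p) (z : ℂ) :
    HasFDerivAt (powerMap p) (powerMapDeriv p z) z := by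
  rcases eq_or_ne z 0 with rfl | hz
  · rw [powerMapDeriv_zero hp, hasFDerivAt_iff_isLittleO_nhds_zero]
    have h1 : (fun h : ℂ => ‖h‖ ^ (p - 1) * ‖h‖) =o[𝓝 0] fun h : ℂ => 1 * ‖h‖ := by
      refine Asymptotics.IsLittleO.mul_isBigO ?_ (Asymptotics.isBigO_refl _ _)
      exact (Asymptotics.isLittleO_one_iff ℝ).2 (tendsto_norm_rpow_zero (by linarith))
    simp only [one_mul] at h1
    refine Asymptotics.IsLittleO.of_norm_left (Asymptotics.IsLittleO.of_norm_right ?_)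
    refine h1.congr_left fun h => ?_
    rw [zero_add, powerMap_zero, sub_zero, zero_apply, sub_zero, norm_powerMap]
  · have hn : 0 < ‖z‖ := norm_pos_iff.2 hz
    -- Away from 0, |z|^{p-1} is differentiated as (|z|²)^{(p-1)/2}.
    have h1 := (hasStrictFDerivAt_norm_sq z).hasFDerivAt.rpow_const (p := (p - 1) / 2)
      (Or.inl (by positivity))
    have h2 := h1.smul (hasFDerivAt_id z)
    have hpow : ∀ y : ℂ, (‖y‖ ^ 2) ^ ((p - 1) / 2) = ‖y‖ ^ (p - 1) := fun y => by
      rw [← Real.rpow_two, ← Real.rpow_mul (norm_nonneg _)]; congr 1; ring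
    have hpow2 : (‖z‖ ^ 2) ^ ((p - 1) / 2 - 1) = ‖z‖ ^ (p - 1 - 2) := by
      rw [← Real.rpow_two, ← Real.rpow_mul (norm_nonneg _)]; congr 1; ring
    have h3 : (fun y : ℂ => (‖y‖ ^ 2) ^ ((p - 1) / 2)) • id = powerMap p := by
      ext1 y
      rw [powerMap_eq_smul, ← hpow]; rfl
    rw [← h3]
    have h4 : powerMapDeriv p z = (‖z‖ ^ 2) ^ ((p - 1) / 2) • ContinuousLinearMap.id ℝ ℂ +
        ContinuousLinearMap.smulRight
          (((p - 1) / 2 * (‖z‖ ^ 2) ^ ((p - 1) / 2 - 1)) • 2 • (innerSL ℝ) z) (id z) := by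
      rw [hpow, hpow2, powerMapDeriv]
      congr 1
      ext1
      simp
      ring
    rw [h4]
    exact h2

theorem continuous_powerMapDeriv {p : ℝ} (hp : 1 < p) : Continuous (powerMapDeriv p) := by
  rw [continuous_iff_continuousAt]
  intro z
  rcases eq_or_ne z 0 with rfl | hz
  · rw [ContinuousAt, powerMapDeriv_zero hp]
    refine squeeze_zero_norm (norm_powerMapDeriv_le hp) ?_
    simpa using (tendsto_norm_rpow_zero (sub_pos.2 hp)).const_mul p
  · have hn : ‖z‖ ≠ 0 := norm_ne_zero_iff.2 hz
    have h1 : ContinuousAt (fun z : ℂ => ‖z‖ ^ (p - 1)) z :=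
      continuous_norm.continuousAt.rpow_const (Or.inl hn)
    have h2 : ContinuousAt (fun z : ℂ => ‖z‖ ^ (p - 1 - 2)) z :=
      continuous_norm.continuousAt.rpow_const (Or.inl hn)
    have h3 : Continuous fun z : ℂ => (innerSL ℝ z).smulRight z :=
      ((ContinuousLinearMap.smulRightL ℝ ℂ ℂ).continuous.comp (innerSL ℝ).continuous).clm_apply
        continuous_id
    exact (h1.smul continuousAt_const).add ((h2.const_mul _).smul h3.continuousAt)

theorem continuous_powerMap {p : ℝ} (hp : 1 < p) : Continuous (powerMap p) :=
  continuous_iff_continuousAt.2 fun z => (hasFDerivAt_powerMap hp z).continuousAt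

theorem norm_powerMapDeriv_le_of_le {p B : ℝ} (hp : 1 < p) {z : ℂ} (hz : ‖z‖ ≤ B) :
    ‖powerMapDeriv p z‖ ≤ p * B ^ (p - 1) :=
  (norm_powerMapDeriv_le hp z).trans (by gcongr)

theorem norm_powerMap_sub_le {p B : ℝ} (hp : 1 < p) {a b : ℂ} (ha : ‖a‖ ≤ B) (hb : ‖b‖ ≤ B) :
    ‖powerMap p a - powerMap p b‖ ≤ p * B ^ (p - 1) * ‖a - b‖ :=
  (convex_closedBall (0 : ℂ) B).norm_image_sub_le_of_norm_hasFDerivWithin_le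
    (fun z _ => (hasFDerivAt_powerMap hp z).hasFDerivWithinAt)
    (fun _ hz => norm_powerMapDeriv_le_of_le hp (mem_closedBall_zero_iff.1 hz))
    (mem_closedBall_zero_iff.2 hb) (mem_closedBall_zero_iff.2 ha)

/-- Uniform continuity on a compact ball stands in for a Lipschitz bound on the derivative, which is
unavailable for p < 2. -/
theorem exists_powerMapDeriv_modulus {p : ℝ} (hp : 1 < p) (B : ℝ) {ε : ℝ} (hε : 0 < ε) :
    ∃ δ > 0, ∀ a b : ℂ, ‖a‖ ≤ B → ‖b‖ ≤ B → ‖a - b‖ < δ →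
      ‖powerMapDeriv p a - powerMapDeriv p b‖ ≤ ε := by
  have h := (isCompact_closedBall (0 : ℂ) B).uniformContinuousOn_of_continuous
    (continuous_powerMapDeriv hp).continuousOn
  obtain ⟨δ, hδ, h⟩ := Metric.uniformContinuousOn_iff.1 h ε hε
  refine ⟨δ, hδ, fun a b ha hb hab => ?_⟩
  have := h a (mem_closedBall_zero_iff.2 ha) b (mem_closedBall_zero_iff.2 hb)
    (by rwa [dist_eq_norm])
  rw [dist_eq_norm] at this
  exact this.le

theorem exists_powerMap_taylor {p : ℝ} (hp : 1 < p) (B : ℝ) {ε : ℝ} (hε : 0 < ε) :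
    ∃ δ > 0, ∀ a b : ℂ, ‖a‖ ≤ B → ‖b‖ ≤ B → ‖b - a‖ < δ →
      ‖powerMap p b - powerMap p a - powerMapDeriv p a (b - a)‖ ≤ ε * ‖b - a‖ := by
  obtain ⟨δ, hδ, h⟩ := exists_powerMapDeriv_modulus hp B hε
  refine ⟨δ, hδ, fun a b ha hb hab => ?_⟩
  have hconv : Convex ℝ (Metric.closedBall (0 : ℂ) B ∩ Metric.ball a δ) :=
    (convex_closedBall _ _).inter (convex_ball _ _)
  refine hconv.norm_image_sub_le_of_norm_hasFDerivWithin_le' (f := powerMap p)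
    (fun z _ => (hasFDerivAt_powerMap hp z).hasFDerivWithinAt) (fun z hz => ?_)
    ⟨mem_closedBall_zero_iff.2 ha, Metric.mem_ball_self hδ⟩
    ⟨mem_closedBall_zero_iff.2 hb, by rwa [Metric.mem_ball, dist_eq_norm]⟩
  exact h z a (mem_closedBall_zero_iff.1 hz.1) ha (by simpa [dist_eq_norm] using hz.2)

/-! ### The nonlinearity on `H¹` -/

theorem norm_le_of_ae_norm_le_add {F f g : L2} {k l : ℝ} (hk : 0 ≤ k) (hl : 0 ≤ l)
    (h : ∀ᵐ x, ‖F x‖ ≤ k * ‖f x‖ + l * ‖g x‖) : ‖F‖ ≤ k * ‖f‖ + l * ‖g‖ := by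
  have hn : ∀ f : L2, ‖(Lp.memLp f).norm.toLp‖ = ‖f‖ := fun f => by
    rw [Lp.norm_toLp, eLpNorm_norm, Lp.norm_def]
  set f' := (Lp.memLp f).norm.toLp
  set g' := (Lp.memLp g).norm.toLp
  have h1 : ‖F‖ ≤ ‖k • f' + l • g'‖ := by
    refine Lp.norm_le_norm_of_ae_le ?_
    filter_upwards [h, Lp.coeFn_add (k • f') (l • g'), Lp.coeFn_smul k f', Lp.coeFn_smul l g',
      (Lp.memLp f).norm.coeFn_toLp, (Lp.memLp g).norm.coeFn_toLp] with x h1 h2 h3 h4 h5 h6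
    rw [h2, Pi.add_apply, h3, h4, Pi.smul_apply, Pi.smul_apply, h5, h6]
    exact h1.trans (le_abs_self _)
  refine h1.trans ((norm_add_le _ _).trans ?_)
  rw [norm_smul, norm_smul, hn, hn, Real.norm_of_nonneg hk, Real.norm_of_nonneg hl]

theorem memLp_powerMap {p : ℝ} (hp : 1 < p) (w : H1) :
    MemLp (fun x => powerMap p (toL2 w x)) 2 volume := by
  refine (Lp.memLp (toL2 w)).of_le_mul (c := (2 * ‖w‖) ^ (p - 1))
    ((continuous_powerMap hp).comp_aestronglyMeasurable (Lp.aestronglyMeasurable _)) ?_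
  filter_upwards [ae_norm_toL2_le_norm w] with x hx
  rw [norm_powerMap]
  gcongr

theorem memLp_powerMapDeriv {p : ℝ} (hp : 1 < p) (w : H1) (v : L2) :
    MemLp (fun x => powerMapDeriv p (toL2 w x) (v x)) 2 volume := by
  refine (Lp.memLp v).of_le_mul (c := p * (2 * ‖w‖) ^ (p - 1)) ?_ ?_
  · have h : Continuous fun q : ℂ × ℂ => powerMapDeriv p q.1 q.2 :=
      ((continuous_powerMapDeriv hp).comp continuous_fst).clm_apply continuous_snd
    have h2 : AEStronglyMeasurable (fun x => ((toL2 w x, v x) : ℂ × ℂ)) volume :=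
      (Lp.aestronglyMeasurable (toL2 w)).prodMk (Lp.aestronglyMeasurable v)
    have h3 : AEStronglyMeasurable
        ((fun q : ℂ × ℂ => powerMapDeriv p q.1 q.2) ∘ fun x => ((toL2 w x, v x) : ℂ × ℂ)) volume :=
      h.comp_aestronglyMeasurable h2
    exact h3
  · filter_upwards [ae_norm_toL2_le_norm w] with x hx
    exact (ContinuousLinearMap.le_opNorm _ _).trans
      (by gcongr; exact norm_powerMapDeriv_le_of_le hp hx)

/-- `|w|^{p-1} w` as an `L²` function, for `w ∈ H¹`. -/
def powerL2 {p : ℝ} (hp : 1 < p) (w : H1) : L2 := (memLp_powerMap hp w).toLp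

/-- The derivative of `|w|^{p-1} w` at `w ∈ H¹` in a direction `v ∈ L²`. -/
def powerDerivL2 {p : ℝ} (hp : 1 < p) (w : H1) (v : L2) : L2 := (memLp_powerMapDeriv hp w v).toLp

theorem powerL2_coeFn {p : ℝ} (hp : 1 < p) (w : H1) :
    ∀ᵐ x, powerL2 hp w x = powerMap p (toL2 w x) := MemLp.coeFn_toLp _

theorem powerDerivL2_coeFn {p : ℝ} (hp : 1 < p) (w : H1) (v : L2) :
    ∀ᵐ x, powerDerivL2 hp w v x = powerMapDeriv p (toL2 w x) (v x) := MemLp.coeFn_toLp _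

theorem unitaryGroup_translation_powerL2 {p : ℝ} (hp : 1 < p) (w : H1) (t : ℝ) :
    unitaryGroup translationSymbol t (powerL2 hp w) =
      powerL2 hp (h1Group translationSymbol t w) := by
  ext1
  filter_upwards [unitaryGroup_translation_coeFn t (powerL2 hp w),
    unitaryGroup_translation_coeFn t (toL2 w), powerL2_coeFn hp (h1Group translationSymbol t w),
    (measurePreserving_add_right volume t).quasiMeasurePreserving.ae (powerL2_coeFn hp w)]
    with x h1 h2 h3 h4
  rw [h1, h3, h4, toL2_h1Group, h2]

/-- The chain rule: `|w|^{p-1} w` is weakly differentiable for `w ∈ H¹`. -/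
theorem isWeakDeriv_powerL2 {p : ℝ} (hp : 1 < p) (w : H1) :
    IsWeakDeriv (powerL2 hp w) (powerDerivL2 hp w (weakDeriv w)) := by
  have hw := (isWeakDeriv_iff_hasDerivAt _ _).1 (isWeakDeriv_weakDeriv w)
  rw [isWeakDeriv_iff_hasDerivAt]
  rw [hasDerivAt_iff_isLittleO] at hw ⊢
  simp only [unitaryGroup_zero, sub_zero] at hw ⊢
  set K := p * (2 * ‖w‖) ^ (p - 1) with hK
  set D := ‖weakDeriv w‖ with hD
  have hK0 : 0 ≤ K := by positivity
  rw [Asymptotics.isLittleO_iff]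
  intro c hc
  -- The error below is at most ε(D + 1)|t| + Kη|t|; ε and η make each term at most (c/2)|t|.
  set ε := c / (2 * (D + 1)) with hε
  set η := min 1 (c / (2 * (K + 1))) with hη
  have hD0 : 0 ≤ D := norm_nonneg _
  have hε0 : 0 < ε := by positivity
  have hη0 : 0 < η := lt_min one_pos (by positivity)
  obtain ⟨δ, hδ, hT⟩ := exists_powerMap_taylor hp (2 * ‖w‖) hε0
  -- The embedding constant 2 turns δ/2 in `H1` into a uniform bound by δ, as the Taylor estimate
  -- requires.
  have hcont : ∀ᶠ t in 𝓝 (0 : ℝ), ‖h1Group translationSymbol t w - w‖ < δ / 2 := by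
    have h1 := (continuous_h1Group translationSymbol w).tendsto 0
    rw [h1Group_zero] at h1
    exact (tendsto_iff_norm_sub_tendsto_zero.1 h1).eventually_lt_const (by positivity)
  filter_upwards [hcont, (Asymptotics.isLittleO_iff.1 hw) hη0] with t ht1 ht2
  set τ := h1Group translationSymbol t w with hτ
  have hτn : ‖τ‖ = ‖w‖ := LinearIsometry.norm_map _ _
  have hsub : ‖toL2 τ - toL2 w‖ ≤ (D + 1) * ‖t‖ := by
    have h1 : toL2 τ - toL2 w = (toL2 τ - toL2 w - t • weakDeriv w) + t • weakDeriv w := by abel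
    rw [h1]
    refine (norm_add_le _ _).trans ?_
    rw [norm_smul]
    have h2 : ‖toL2 τ - toL2 w - t • weakDeriv w‖ ≤ 1 * ‖t‖ :=
      ht2.trans (by gcongr; exact min_le_left _ _)
    linarith
  rw [unitaryGroup_translation_powerL2]
  have hmain : ‖powerL2 hp τ - powerL2 hp w - t • powerDerivL2 hp w (weakDeriv w)‖ ≤
      ε * ‖toL2 τ - toL2 w‖ + K * ‖toL2 τ - toL2 w - t • weakDeriv w‖ := by
    refine norm_le_of_ae_norm_le_add hε0.le hK0 ?_
    filter_upwards [ae_norm_toL2_le_norm w, ae_norm_toL2_le_norm τ, ae_norm_toL2_le_norm (τ - w),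
      powerL2_coeFn hp w, powerL2_coeFn hp τ, powerDerivL2_coeFn hp w (weakDeriv w),
      Lp.coeFn_sub (toL2 τ) (toL2 w), Lp.coeFn_sub (toL2 τ - toL2 w) (t • weakDeriv w),
      Lp.coeFn_sub (powerL2 hp τ) (powerL2 hp w),
      Lp.coeFn_sub (powerL2 hp τ - powerL2 hp w) (t • powerDerivL2 hp w (weakDeriv w)),
      Lp.coeFn_smul t (weakDeriv w), Lp.coeFn_smul t (powerDerivL2 hp w (weakDeriv w))]
      with x b1 b2 b3 e1 e2 e3 s1 s2 s3 s4 m1 m2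
    rw [hτn] at b2
    rw [toL2_sub, s1, Pi.sub_apply] at b3
    rw [s4, Pi.sub_apply, s3, Pi.sub_apply, m2, Pi.smul_apply, e1, e2, e3, s2, Pi.sub_apply, s1,
      Pi.sub_apply, m1, Pi.smul_apply]
    set a := toL2 w x
    set b := toL2 τ x
    set d := weakDeriv w x
    have h1 : powerMap p b - powerMap p a - t • powerMapDeriv p a d =
        (powerMap p b - powerMap p a - powerMapDeriv p a (b - a)) +
          powerMapDeriv p a (b - a - t • d) := by
      rw [map_sub (powerMapDeriv p a) (b - a), map_smul]; abel
    rw [h1]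
    refine (norm_add_le _ _).trans (add_le_add (hT a b b1 b2 (by linarith)) ?_)
    exact (ContinuousLinearMap.le_opNorm _ _).trans
      (by gcongr; exact norm_powerMapDeriv_le_of_le hp b1)
  refine hmain.trans ?_
  have h1 : ε * ‖toL2 τ - toL2 w‖ ≤ ε * ((D + 1) * ‖t‖) := by gcongr
  have h2 : K * ‖toL2 τ - toL2 w - t • weakDeriv w‖ ≤ K * (c / (2 * (K + 1)) * ‖t‖) := by
    gcongr
    exact ht2.trans (by gcongr; exact min_le_right _ _)
  have h3 : ε * ((D + 1) * ‖t‖) = c / 2 * ‖t‖ := by rw [hε]; field_simp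
  have h4 : K * (c / (2 * (K + 1)) * ‖t‖) ≤ c / 2 * ‖t‖ := by
    have : K * (c / (2 * (K + 1)) * ‖t‖) = (K / (K + 1)) * (c / 2 * ‖t‖) := by field_simp
    rw [this]
    refine mul_le_of_le_one_left (by positivity) ?_
    rw [div_le_one (by positivity)]
    linarith
  linarith

/-- The nonlinearity `w ↦ |w|^{p-1} w` on `H¹`. -/
def powerH1 {p : ℝ} (hp : 1 < p) (w : H1) : H1 := mkH1 _ _ (isWeakDeriv_powerL2 hp w)

theorem norm_powerH1_le {p M : ℝ} (hp : 1 < p) {w : H1} (hw : ‖w‖ ≤ M) :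
    ‖powerH1 hp w‖ ≤ 2 * (p * (2 * M) ^ (p - 1)) * ‖w‖ := by
  have hM : 0 ≤ M := (norm_nonneg _).trans hw
  have hp0 : 0 ≤ p := by linarith
  have h1 : ‖powerL2 hp w‖ ≤ p * (2 * M) ^ (p - 1) * ‖toL2 w‖ := by
    refine Lp.norm_le_mul_norm_of_ae_le_mul ?_
    filter_upwards [powerL2_coeFn hp w, ae_norm_toL2_le_norm w] with x h1 h2
    have := norm_powerMap_sub_le hp (B := 2 * M) (h2.trans (by gcongr)) (b := 0)
      (by rw [norm_zero]; positivity)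
    rwa [powerMap_zero, sub_zero, sub_zero, ← h1] at this
  have h2 : ‖powerDerivL2 hp w (weakDeriv w)‖ ≤ p * (2 * M) ^ (p - 1) * ‖weakDeriv w‖ := by
    refine Lp.norm_le_mul_norm_of_ae_le_mul ?_
    filter_upwards [powerDerivL2_coeFn hp w (weakDeriv w), ae_norm_toL2_le_norm w] with x h1 h2
    rw [h1]
    exact (ContinuousLinearMap.le_opNorm _ _).trans
      (by gcongr; exact norm_powerMapDeriv_le_of_le hp (h2.trans (by gcongr)))
  refine (norm_H1_le _).trans ?_
  rw [powerH1, toL2_mkH1, weakDeriv_mkH1]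
  have hK : 0 ≤ p * (2 * M) ^ (p - 1) := by positivity
  nlinarith [norm_toL2_le w, norm_weakDeriv_le w]

theorem norm_toL2_powerH1_sub_le {p M : ℝ} (hp : 1 < p) {v w : H1} (hv : ‖v‖ ≤ M) (hw : ‖w‖ ≤ M) :
    ‖toL2 (powerH1 hp v - powerH1 hp w)‖ ≤ p * (2 * M) ^ (p - 1) * ‖toL2 (v - w)‖ := by
  refine Lp.norm_le_mul_norm_of_ae_le_mul ?_
  filter_upwards [powerL2_coeFn hp v, powerL2_coeFn hp w, ae_norm_toL2_le_norm v,
    ae_norm_toL2_le_norm w, Lp.coeFn_sub (powerL2 hp v) (powerL2 hp w),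
    Lp.coeFn_sub (toL2 v) (toL2 w)] with x e1 e2 b1 b2 s1 s2
  rw [toL2_sub, toL2_sub, powerH1, powerH1, toL2_mkH1, toL2_mkH1, s1, s2, Pi.sub_apply,
    Pi.sub_apply, e1, e2]
  exact norm_powerMap_sub_le hp (b1.trans (by gcongr)) (b2.trans (by gcongr))

/-- On bounded sets of `H¹`, functions that are close in `L²` are uniformly close. -/
theorem exists_ae_norm_lt (M : ℝ) {δ : ℝ} (hδ : 0 < δ) :
    ∃ η > 0, ∀ w : H1, ‖w‖ ≤ M → ‖toL2 w‖ < η → ∀ᵐ x, ‖toL2 w x‖ < δ := by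
  -- This A makes the derivative term (|M| + 1)/√A of Agmon's inequality equal to δ/2, and η = (|M|
  -- + 1)/A does the same for the L² term.
  set A : ℝ := ((2 * (|M| + 1)) / δ) ^ 2 with hA
  have hM : 0 < |M| + 1 := by positivity
  have hsA : √A = 2 * (|M| + 1) / δ := Real.sqrt_sq (by positivity)
  have hA0 : 0 < A := by positivity
  refine ⟨(|M| + 1) / A, by positivity, fun w hw hη => ?_⟩
  filter_upwards [ae_norm_toL2_le w hA0] with x hx
  refine hx.trans_lt ?_
  have h1 : ‖weakDeriv w‖ ≤ |M| + 1 :=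
    (norm_weakDeriv_le w).trans (by linarith [le_abs_self M])
  have h2 : ‖toL2 w‖ + A⁻¹ * ‖weakDeriv w‖ < (|M| + 1) / A + A⁻¹ * (|M| + 1) :=
    add_lt_add_of_lt_of_le hη (by gcongr)
  have h3 : √A * ((|M| + 1) / A + A⁻¹ * (|M| + 1)) = δ := by
    rw [hsA, hA]; field_simp; ring
  calc _ < √A * ((|M| + 1) / A + A⁻¹ * (|M| + 1)) := by
        have : 0 < √A := Real.sqrt_pos.2 hA0
        gcongr
    _ = δ := h3

/-- The derivatives differ by N'(v)(v' - w') + (N'(v) - N'(w))w'. The first term is Lipschitz. In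
the second, L²-closeness and the `H1` bounds make v - w uniformly small, so the modulus of
continuity of N' makes the term at most ε. -/
theorem exists_norm_powerH1_sub_le {p M : ℝ} (hp : 1 < p) {ε : ℝ} (hε : 0 < ε) :
    ∃ η > 0, ∀ v w : H1, ‖v‖ ≤ M → ‖w‖ ≤ M → ‖toL2 (v - w)‖ < η →
      ‖powerH1 hp v - powerH1 hp w‖ ≤ 2 * (p * (2 * M) ^ (p - 1)) * ‖v - w‖ + ε := by
  by_cases hM : 0 ≤ M
  swap
  · exact ⟨1, one_pos, fun v w hv => absurd ((norm_nonneg v).trans hv) hM⟩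
  obtain ⟨δ, hδ, hmod⟩ := exists_powerMapDeriv_modulus hp (2 * M)
    (show 0 < ε / (M + 1) by positivity)
  obtain ⟨η, hη, hsup⟩ := exists_ae_norm_lt (2 * M) hδ
  refine ⟨η, hη, fun v w hv hw hvw => ?_⟩
  have hn : ‖v - w‖ ≤ 2 * M := (norm_sub_le _ _).trans (by linarith)
  set K := p * (2 * M) ^ (p - 1) with hK
  have hK0 : 0 ≤ K := by positivity
  have h1 := norm_toL2_powerH1_sub_le hp hv hw
  have h2 : ‖weakDeriv (powerH1 hp v - powerH1 hp w)‖ ≤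
      K * ‖weakDeriv (v - w)‖ + ε / (M + 1) * ‖weakDeriv w‖ := by
    refine norm_le_of_ae_norm_le_add hK0 (by positivity) ?_
    filter_upwards [powerDerivL2_coeFn hp v (weakDeriv v), powerDerivL2_coeFn hp w (weakDeriv w),
      ae_norm_toL2_le_norm v, ae_norm_toL2_le_norm w, hsup (v - w) hn hvw,
      Lp.coeFn_sub (powerDerivL2 hp v (weakDeriv v)) (powerDerivL2 hp w (weakDeriv w)),
      Lp.coeFn_sub (weakDeriv v) (weakDeriv w), Lp.coeFn_sub (toL2 v) (toL2 w)]
      with x e1 e2 b1 b2 b3 s1 s2 s3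
    rw [toL2_sub, s3, Pi.sub_apply] at b3
    rw [weakDeriv_sub, weakDeriv_sub, powerH1, powerH1, weakDeriv_mkH1, weakDeriv_mkH1, s1, s2,
      Pi.sub_apply, Pi.sub_apply, e1, e2]
    have b1' : ‖toL2 v x‖ ≤ 2 * M := b1.trans (by gcongr)
    have b2' : ‖toL2 w x‖ ≤ 2 * M := b2.trans (by gcongr)
    have h : powerMapDeriv p (toL2 v x) (weakDeriv v x) - powerMapDeriv p (toL2 w x) (weakDeriv w x)
        = powerMapDeriv p (toL2 v x) (weakDeriv v x - weakDeriv w x) +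
          (powerMapDeriv p (toL2 v x) - powerMapDeriv p (toL2 w x)) (weakDeriv w x) := by
      rw [map_sub, sub_apply]; abel
    rw [h]
    refine (norm_add_le _ _).trans (add_le_add ?_ ?_)
    · exact (ContinuousLinearMap.le_opNorm _ _).trans
        (by gcongr; exact norm_powerMapDeriv_le_of_le hp b1')
    · exact (ContinuousLinearMap.le_opNorm _ _).trans
        (by gcongr; exact hmod _ _ b1' b2' b3)
  have h3 : ε / (M + 1) * ‖weakDeriv w‖ ≤ ε := by
    have : ‖weakDeriv w‖ ≤ M + 1 := (norm_weakDeriv_le w).trans (by linarith)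
    calc _ ≤ ε / (M + 1) * (M + 1) := by gcongr
      _ = ε := by field_simp
  refine (norm_H1_le _).trans ?_
  nlinarith [norm_toL2_le (v - w), norm_weakDeriv_le (v - w)]

theorem continuous_powerH1 {p : ℝ} (hp : 1 < p) : Continuous (powerH1 hp) := by
  rw [continuous_iff_continuousAt]
  intro w
  rw [Metric.continuousAt_iff]
  intro ε hε
  set M := ‖w‖ + 1 with hM
  obtain ⟨η, hη, h⟩ := exists_norm_powerH1_sub_le (M := M) hp (half_pos hε)
  set K := 2 * (p * (2 * M) ^ (p - 1)) with hK
  have hK0 : 0 ≤ K := by positivity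
  refine ⟨min (min 1 η) (ε / (2 * (K + 1))), by positivity, fun v hv => ?_⟩
  rw [dist_eq_norm] at hv ⊢
  have h1 : ‖v - w‖ < 1 := hv.trans_le ((min_le_left _ _).trans (min_le_left _ _))
  have h2 : ‖v - w‖ < η := hv.trans_le ((min_le_left _ _).trans (min_le_right _ _))
  have h3 : ‖v - w‖ < ε / (2 * (K + 1)) := hv.trans_le (min_le_right _ _)
  have h4 : ‖v‖ ≤ M := by
    have := norm_sub_norm_le v w
    linarith
  have h5 := h v w h4 (by linarith) ((norm_toL2_le _).trans_lt h2)
  rw [lt_div_iff₀ (by positivity)] at h3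
  nlinarith [norm_nonneg (v - w)]

theorem isPowerNonlinearity_powerH1 {p : ℝ} (hp : 1 < p) (w : H1) :
    IsPowerNonlinearity p (toL2 w) (toL2 (powerH1 hp w)) :=
  powerL2_coeFn hp w

/-! ### Picard iteration for a field that is Lipschitz only in a weaker norm -/

section Picard

variable {H X : Type*} [NormedAddCommGroup H] [NormedSpace ℝ H]
  [NormedAddCommGroup X] [NormedSpace ℝ X]

/-- The Picard iterates of `w' = G(t, w)`, `w(0) = w₀`. -/
def picardIter (G : ℝ → H → H) (w₀ : H) : ℕ → ℝ → H
  | 0 => fun _ => w₀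
  | n + 1 => fun t => w₀ + ∫ s in (0 : ℝ)..t, G s (picardIter G w₀ n s)

variable {G : ℝ → H → H} {w₀ : H} {M K T : ℝ}

theorem continuous_picardIter (hG : Continuous fun q : ℝ × H => G q.1 q.2) (n : ℕ) :
    Continuous (picardIter G w₀ n) := by
  induction n with
  | zero => exact continuous_const
  | succ n ih =>
    have h : Continuous fun s => G s (picardIter G w₀ n s) := hG.comp (continuous_id.prodMk ih)
    exact continuous_const.add
      (intervalIntegral.continuous_primitive (fun a b => h.intervalIntegrable a b) 0)

theorem norm_intervalIntegral_le_of_mem_Icc {g : ℝ → H} {C t : ℝ} (hC : 0 ≤ C)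
    (hg : ∀ s ∈ Icc 0 T, ‖g s‖ ≤ C) (ht : t ∈ Icc 0 T) : ‖∫ s in (0 : ℝ)..t, g s‖ ≤ T * C := by
  have h := intervalIntegral.norm_integral_le_of_norm_le_const (f := g) (a := 0) (b := t) (C := C)
    fun s hs => by
      rw [uIoc_of_le ht.1] at hs
      exact hg s ⟨hs.1.le, hs.2.trans ht.2⟩
  rw [sub_zero, abs_of_nonneg ht.1, mul_comm] at h
  exact h.trans (mul_le_mul_of_nonneg_right ht.2 hC)

/-- The data use half of the radius M and the integral at most T K M ≤ M/2. -/
theorem norm_picardIter_le (hT : 0 ≤ T) (hK : 0 ≤ K) (hTK : T * K ≤ 1 / 2)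
    (hgrow : ∀ t w, ‖w‖ ≤ M → ‖G t w‖ ≤ K * M) (hw₀ : ‖w₀‖ ≤ M / 2) (n : ℕ) :
    ∀ t ∈ Icc 0 T, ‖picardIter G w₀ n t‖ ≤ M := by
  have hM : 0 ≤ M := by linarith [norm_nonneg w₀]
  induction n with
  | zero => intro t _; exact hw₀.trans (by linarith)
  | succ n ih =>
    intro t ht
    have h := norm_intervalIntegral_le_of_mem_Icc (mul_nonneg hK hM)
      (fun s hs => hgrow s _ (ih s hs)) ht
    have h2 : T * (K * M) ≤ 1 / 2 * M := by rw [← mul_assoc]; gcongr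
    exact (norm_add_le _ _).trans (by linarith)

theorem picardIter_succ_sub (hG : Continuous fun q : ℝ × H => G q.1 q.2) (n m : ℕ) (t : ℝ) :
    picardIter G w₀ (n + 1) t - picardIter G w₀ (m + 1) t =
      ∫ s in (0 : ℝ)..t, (G s (picardIter G w₀ n s) - G s (picardIter G w₀ m s)) := by
  have h : ∀ n, Continuous fun s => G s (picardIter G w₀ n s) := fun n =>
    hG.comp (continuous_id.prodMk (continuous_picardIter hG n))
  rw [intervalIntegral.integral_sub ((h n).intervalIntegrable _ _) ((h m).intervalIntegrable _ _)]
  simp [picardIter]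

/-- Each step contracts the weak norm by T K ≤ 1/2. Comparing all pairs of indices beyond N gives
the Cauchy property without summing a series. -/
theorem norm_weak_picardIter_sub_le [CompleteSpace H] [CompleteSpace X] (ι : H →L[ℝ] X)
    (hG : Continuous fun q : ℝ × H => G q.1 q.2)
    (hT : 0 ≤ T) (hK : 0 ≤ K) (hTK : T * K ≤ 1 / 2)
    (hgrow : ∀ t w, ‖w‖ ≤ M → ‖G t w‖ ≤ K * M) (hw₀ : ‖w₀‖ ≤ M / 2)
    (hlip : ∀ t v w, ‖v‖ ≤ M → ‖w‖ ≤ M → ‖ι (G t v - G t w)‖ ≤ K * ‖ι (v - w)‖) (N : ℕ) :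
    ∀ n ≥ N, ∀ m ≥ N, ∀ t ∈ Icc 0 T, ‖ι (picardIter G w₀ n t - picardIter G w₀ m t)‖ ≤
      (1 / 2) ^ N * (‖ι‖ * (2 * M)) := by
  have hM : 0 ≤ M := by linarith [norm_nonneg w₀]
  have hb := norm_picardIter_le hT hK hTK hgrow hw₀
  induction N with
  | zero =>
    intro n _ m _ t ht
    rw [pow_zero, one_mul]
    refine (ι.le_opNorm _).trans ?_
    gcongr
    exact (norm_sub_le _ _).trans (by linarith [hb n t ht, hb m t ht])
  | succ N ih =>
    intro n hn m hm t ht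
    obtain ⟨n, rfl⟩ : ∃ k, n = k + 1 := ⟨n - 1, by omega⟩
    obtain ⟨m, rfl⟩ : ∃ k, m = k + 1 := ⟨m - 1, by omega⟩
    have h : ∀ n, Continuous fun s => G s (picardIter G w₀ n s) := fun n =>
      hG.comp (continuous_id.prodMk (continuous_picardIter hG n))
    have hint : IntervalIntegrable
        (fun s => G s (picardIter G w₀ n s) - G s (picardIter G w₀ m s)) volume 0 t :=
      ((h n).sub (h m)).intervalIntegrable _ _
    rw [picardIter_succ_sub hG, ← ι.intervalIntegral_comp_comm hint]
    refine (norm_intervalIntegral_le_of_mem_Icc (C := K * ((1 / 2) ^ N * (‖ι‖ * (2 * M))))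
      (by positivity) (fun s hs => ?_) ht).trans ?_
    · refine (hlip s _ _ (hb n s hs) (hb m s hs)).trans ?_
      gcongr
      exact ih n (by omega) m (by omega) s hs
    · rw [← mul_assoc, pow_succ']
      calc _ ≤ 1 / 2 * ((1 / 2) ^ N * (‖ι‖ * (2 * M))) := by gcongr
        _ = _ := by ring

/-- The strong distances obey d_{k+1} ≤ d_k/2 + Tε, whose fixed point is 2Tε; the excess over it is
halved at each step. -/
theorem norm_picardIter_sub_le {ε : ℝ} {N₀ : ℕ} (hε : 0 ≤ ε)
    (hG : Continuous fun q : ℝ × H => G q.1 q.2)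
    (hT : 0 ≤ T) (hK : 0 ≤ K) (hTK : T * K ≤ 1 / 2)
    (hgrow : ∀ t w, ‖w‖ ≤ M → ‖G t w‖ ≤ K * M) (hw₀ : ‖w₀‖ ≤ M / 2)
    (hquasi : ∀ n ≥ N₀, ∀ m ≥ N₀, ∀ t ∈ Icc 0 T,
      ‖G t (picardIter G w₀ n t) - G t (picardIter G w₀ m t)‖ ≤
        K * ‖picardIter G w₀ n t - picardIter G w₀ m t‖ + ε) (k : ℕ) :
    ∀ n ≥ N₀ + k, ∀ m ≥ N₀ + k, ∀ t ∈ Icc 0 T, ‖picardIter G w₀ n t - picardIter G w₀ m t‖ ≤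
      (1 / 2) ^ k * (2 * M) + 2 * T * ε := by
  have hM : 0 ≤ M := by linarith [norm_nonneg w₀]
  have hb := norm_picardIter_le hT hK hTK hgrow hw₀
  induction k with
  | zero =>
    intro n _ m _ t ht
    rw [pow_zero, one_mul]
    have : 0 ≤ 2 * T * ε := by positivity
    exact (norm_sub_le _ _).trans (by linarith [hb n t ht, hb m t ht])
  | succ k ih =>
    intro n hn m hm t ht
    obtain ⟨n, rfl⟩ : ∃ k, n = k + 1 := ⟨n - 1, by omega⟩
    obtain ⟨m, rfl⟩ : ∃ k, m = k + 1 := ⟨m - 1, by omega⟩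
    rw [picardIter_succ_sub hG]
    refine (norm_intervalIntegral_le_of_mem_Icc
      (C := K * ((1 / 2) ^ k * (2 * M) + 2 * T * ε) + ε)
      (by positivity) (fun s hs => ?_) ht).trans ?_
    · refine (hquasi n (by omega) m (by omega) s hs).trans ?_
      gcongr
      exact ih n (by omega) m (by omega) s hs
    · calc _ = T * K * ((1 / 2) ^ k * (2 * M) + 2 * T * ε) + T * ε := by ring
        _ ≤ 1 / 2 * ((1 / 2) ^ k * (2 * M) + 2 * T * ε) + T * ε := by gcongr
        _ = _ := by rw [pow_succ']; ring

/-- Local existence for `w' = G(t, w)` when `G` is Lipschitz for a weaker norm and Lipschitz up to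
a small error for the strong norm. -/
theorem exists_hasDerivWithinAt_of_quasiLipschitz [CompleteSpace H] [CompleteSpace X]
    (ι : H →L[ℝ] X)
    (hG : Continuous fun q : ℝ × H => G q.1 q.2)
    (hT : 0 ≤ T) (hK : 0 ≤ K) (hTK : T * K ≤ 1 / 2)
    (hgrow : ∀ t w, ‖w‖ ≤ M → ‖G t w‖ ≤ K * M) (hw₀ : ‖w₀‖ ≤ M / 2)
    (hlip : ∀ t v w, ‖v‖ ≤ M → ‖w‖ ≤ M → ‖ι (G t v - G t w)‖ ≤ K * ‖ι (v - w)‖)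
    (hquasi : ∀ ε > 0, ∃ η > 0, ∀ t v w, ‖v‖ ≤ M → ‖w‖ ≤ M → ‖ι (v - w)‖ < η →
      ‖G t v - G t w‖ ≤ K * ‖v - w‖ + ε) :
    ∃ w : ℝ → H, w 0 = w₀ ∧ ∀ t ∈ Icc 0 T, HasDerivWithinAt w (G t (w t)) (Icc 0 T) t := by
  have hb := norm_picardIter_le hT hK hTK hgrow hw₀
  have hpow : ∀ c : ℝ, Tendsto (fun N : ℕ => (1 / 2 : ℝ) ^ N * c) atTop (𝓝 0) := fun c => by
    simpa using (tendsto_pow_atTop_nhds_zero_of_lt_one (r := (1 / 2 : ℝ)) (by norm_num)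
      (by norm_num)).mul_const c
  have hcauchy : UniformCauchySeqOn (picardIter G w₀) atTop (Icc 0 T) := by
    rw [Metric.uniformCauchySeqOn_iff]
    intro δ hδ
    -- This makes the residual 2Tε at most δ/2. Then N₀ is taken so large that the weak distances
    -- fall below the η belonging to ε, and k so large that the geometric term is below δ/2.
    set ε := δ / (4 * (T + 1)) with hε
    obtain ⟨η, hη, hq⟩ := hquasi ε (by positivity)
    obtain ⟨N₀, hN₀⟩ := ((hpow (‖ι‖ * (2 * M))).eventually_lt_const hη).exists
    obtain ⟨k, hk⟩ := ((hpow (2 * M)).eventually_lt_const (half_pos hδ)).exists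
    have hw := norm_weak_picardIter_sub_le ι hG hT hK hTK hgrow hw₀ hlip N₀
    have hs := norm_picardIter_sub_le (N₀ := N₀) (ε := ε) (by positivity) hG hT hK hTK hgrow hw₀
      (fun n hn m hm t ht => hq t _ _ (hb n t ht) (hb m t ht) ((hw n hn m hm t ht).trans_lt hN₀)) k
    refine ⟨N₀ + k, fun n hn m hm t ht => ?_⟩
    rw [dist_eq_norm]
    refine (hs n hn m hm t ht).trans_lt ?_
    have h2 : 2 * T * ε ≤ δ / 2 := by
      have : 2 * T * ε = T / (T + 1) * (δ / 2) := by rw [hε]; field_simp; ring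
      rw [this]
      refine mul_le_of_le_one_left (by positivity) ?_
      rw [div_le_one (by positivity)]; linarith
    linarith
  have hlim : ∀ t ∈ Icc 0 T, ∃ y, Tendsto (fun n => picardIter G w₀ n t) atTop (𝓝 y) :=
    fun t ht => cauchySeq_tendsto_of_complete (hcauchy.cauchySeq ht)
  choose! y hy using hlim
  have hyc : ContinuousOn y (Icc 0 T) :=
    (hcauchy.tendstoUniformlyOn_of_tendsto hy).continuousOn
      (Frequently.of_forall fun n => (continuous_picardIter hG n).continuousOn)
  -- Freezing time at the endpoints of [0, T] makes the integrand continuous on the whole line, so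
  -- its primitive is differentiable also at 0 and T.
  set g : ℝ → H := fun s => G (projIcc 0 T hT s) (y (projIcc 0 T hT s)) with hg
  have hgc : Continuous g := by
    have h1 : Continuous fun s => y (projIcc 0 T hT s) :=
      (continuousOn_iff_continuous_domRestrict.1 hyc).comp continuous_projIcc
    exact hG.comp ((continuous_subtype_val.comp (continuous_projIcc (h := hT))).prodMk h1)
  have hgy : ∀ s ∈ Icc 0 T, g s = G s (y s) := fun s hs => by
    simp only [hg, projIcc_of_mem hT hs]
  set W : ℝ → H := fun t => w₀ + ∫ s in (0 : ℝ)..t, g s with hW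
  have hWy : ∀ t ∈ Icc 0 T, W t = y t := by
    intro t ht
    -- The iterates with index n + 1 converge both to y(t) and, by dominated convergence, to the
    -- integral of the limiting field.
    refine tendsto_nhds_unique ?_ ((tendsto_add_atTop_iff_nat 1).2 (hy t ht))
    refine Tendsto.const_add w₀ ?_
    refine intervalIntegral.tendsto_integral_filter_of_dominated_convergence (fun _ => K * M) ?_ ?_
      intervalIntegrable_const ?_
    · refine Eventually.of_forall fun n => Continuous.aestronglyMeasurable ?_
      exact hG.comp (continuous_id.prodMk (continuous_picardIter hG n))
    · refine Eventually.of_forall fun n => Eventually.of_forall fun s hs => ?_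
      rw [uIoc_of_le ht.1] at hs
      exact hgrow s _ (hb n s ⟨hs.1.le, hs.2.trans ht.2⟩)
    · refine Eventually.of_forall fun s hs => ?_
      rw [uIoc_of_le ht.1] at hs
      have hs' : s ∈ Icc 0 T := ⟨hs.1.le, hs.2.trans ht.2⟩
      rw [hgy s hs']
      have hGs : Continuous (G s) := hG.comp (continuous_const.prodMk continuous_id)
      exact (hGs.tendsto _).comp (hy s hs')
  refine ⟨W, by simp [hW], fun t ht => ?_⟩
  have hd : HasDerivAt W (g t) t :=
    (hgc.integral_hasStrictDerivAt 0 t).hasDerivAt.const_add w₀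
  rw [hgy t ht, ← hWy t ht] at hd
  exact hd.hasDerivWithinAt

end Picard

/-! ### Local `H¹` solutions -/

theorem timeInterval_ofReal_subset (T : ℝ) : timeInterval (ENNReal.ofReal T) ⊆ Icc 0 T :=
  fun _ ht => ⟨ht.1, (ENNReal.ofReal_lt_ofReal_iff_of_nonneg ht.1).1 ht.2 |>.le⟩

/-- The field `e^{it|D|} N(e^{-it|D|} w)` of the equation in the interaction picture. -/
def interactionField {p : ℝ} (hp : 1 < p) (t : ℝ) (w : H1) : H1 :=
  h1Group absSymbol (-t) (powerH1 hp (h1Group absSymbol t w))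

theorem continuous_interactionField {p : ℝ} (hp : 1 < p) :
    Continuous fun q : ℝ × H1 => interactionField hp q.1 q.2 := by
  have h1 : Continuous fun q : ℝ × H1 => powerH1 hp (h1Group absSymbol q.1 q.2) :=
    (continuous_powerH1 hp).comp (continuous_h1Group_uncurry absSymbol)
  have h2 : Continuous fun q : ℝ × H1 => (-q.1, powerH1 hp (h1Group absSymbol q.1 q.2)) :=
    continuous_fst.neg.prodMk h1
  have h3 := (continuous_h1Group_uncurry absSymbol).comp h2
  exact h3.congr fun q => rfl

theorem interactionField_sub {p : ℝ} (hp : 1 < p) (t : ℝ) (v w : H1) :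
    interactionField hp t v - interactionField hp t w =
      h1Group absSymbol (-t)
        (powerH1 hp (h1Group absSymbol t v) - powerH1 hp (h1Group absSymbol t w)) :=
  (map_sub (h1Group absSymbol (-t)) _ _).symm

theorem norm_interactionField_le {p M : ℝ} (hp : 1 < p) (t : ℝ) {w : H1} (hw : ‖w‖ ≤ M) :
    ‖interactionField hp t w‖ ≤ 2 * (p * (2 * M) ^ (p - 1)) * M := by
  have hM : 0 ≤ M := (norm_nonneg _).trans hw
  rw [interactionField, LinearIsometry.norm_map]
  have h := norm_powerH1_le hp (w := h1Group absSymbol t w) (M := M)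
    (by rwa [LinearIsometry.norm_map])
  rw [LinearIsometry.norm_map] at h
  exact h.trans (by gcongr)

theorem norm_toL2_interactionField_sub_le {p M : ℝ} (hp : 1 < p) (t : ℝ) {v w : H1}
    (hv : ‖v‖ ≤ M) (hw : ‖w‖ ≤ M) :
    ‖toL2 (interactionField hp t v - interactionField hp t w)‖ ≤
      2 * (p * (2 * M) ^ (p - 1)) * ‖toL2 (v - w)‖ := by
  have hM : 0 ≤ M := (norm_nonneg _).trans hw
  rw [interactionField_sub, toL2_h1Group, norm_unitaryGroup]
  have h := norm_toL2_powerH1_sub_le hp (M := M) (v := h1Group absSymbol t v)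
    (w := h1Group absSymbol t w) (by rwa [LinearIsometry.norm_map])
    (by rwa [LinearIsometry.norm_map])
  rw [← map_sub (h1Group absSymbol t), toL2_h1Group, norm_unitaryGroup] at h
  refine h.trans ?_
  have h2 : 0 ≤ p * (2 * M) ^ (p - 1) * ‖toL2 (v - w)‖ := by positivity
  linarith

theorem exists_norm_interactionField_sub_le {p M : ℝ} (hp : 1 < p) {ε : ℝ} (hε : 0 < ε) :
    ∃ η > 0, ∀ (t : ℝ) (v w : H1), ‖v‖ ≤ M → ‖w‖ ≤ M → ‖toL2 (v - w)‖ < η →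
      ‖interactionField hp t v - interactionField hp t w‖ ≤
        2 * (p * (2 * M) ^ (p - 1)) * ‖v - w‖ + ε := by
  obtain ⟨η, hη, h⟩ := exists_norm_powerH1_sub_le (M := M) hp hε
  refine ⟨η, hη, fun t v w hv hw hvw => ?_⟩
  rw [interactionField_sub, LinearIsometry.norm_map]
  have h1 := h (h1Group absSymbol t v) (h1Group absSymbol t w)
    (by rwa [LinearIsometry.norm_map]) (by rwa [LinearIsometry.norm_map])
    (by rwa [← map_sub (h1Group absSymbol t), toL2_h1Group, norm_unitaryGroup])
  rwa [← map_sub (h1Group absSymbol t), LinearIsometry.norm_map] at h1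

theorem exists_isH1Solution {p M T : ℝ} (hp : 1 < p) (hT : 0 ≤ T) {u₀ : H1} (hu₀ : ‖u₀‖ ≤ M / 2)
    (hTM : T * (2 * (p * (2 * M) ^ (p - 1))) ≤ 1 / 2) :
    ∃ u : ℝ → H1, IsH1Solution p u₀ (ENNReal.ofReal T) u := by
  have hM : 0 ≤ M := by linarith [norm_nonneg u₀]
  obtain ⟨w, hw0, hw⟩ := exists_hasDerivWithinAt_of_quasiLipschitz (M := M)
    (toL2CLM.restrictScalars ℝ) (continuous_interactionField hp) hT (by positivity) hTM
    (fun t _ hw => norm_interactionField_le hp t hw) hu₀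
    (fun t _ _ hv hw => norm_toL2_interactionField_sub_le hp t hv hw)
    (fun _ hε => exists_norm_interactionField_sub_le hp hε)
  -- As `absSymbol` is minus the symbol of |D|, this is u(t) = e^{-it|D|} w(t).
  refine ⟨fun t => h1Group absSymbol t (w t), ?_, ?_, ?_⟩
  · rw [h1Group_zero, hw0]
  · have hwc : ContinuousOn w (Icc 0 T) := fun t ht => (hw t ht).continuousWithinAt
    have hpair : ContinuousOn (fun t => (t, w t)) (Icc 0 T) := continuousOn_id.prodMk hwc
    exact (Continuous.comp_continuousOn (g := fun q : ℝ × H1 => h1Group absSymbol q.1 q.2)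
      (continuous_h1Group_uncurry absSymbol) hpair).mono (timeInterval_ofReal_subset T)
  · intro t ht
    have ht' := timeInterval_ofReal_subset T ht
    refine ⟨unitaryGroup absSymbol t (absD (w t)), toL2 (powerH1 hp (h1Group absSymbol t (w t))),
      isAbsD_unitaryGroup _ _ (isAbsD_absD _), isPowerNonlinearity_powerH1 hp _, ?_⟩
    have h1 : HasDerivWithinAt (fun s => toL2 (w s)) (toL2 (interactionField hp t (w t))) (Icc 0 T) t :=
      (toL2CLM.restrictScalars ℝ).hasFDerivAt.comp_hasDerivWithinAt t (hw t ht')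
    have h2 : ∀ᵐ ξ, (𝓕 (-Complex.I • absD (w t)) : L2) ξ =
        Complex.I * absSymbol ξ * (𝓕 (toL2 (w t)) : L2) ξ := by
      filter_upwards [isAbsD_absD (w t), fourier_smul_coeFn (-Complex.I) (absD (w t))]
        with ξ e1 e2
      rw [e2, e1]
      simp only [absSymbol, ContinuousMap.coe_mk]
      push_cast
      ring
    have h3 := (hasDerivWithinAt_unitaryGroup_apply h1 h2).mono (timeInterval_ofReal_subset T)
    have h4 : unitaryGroup absSymbol t (-Complex.I • absD (w t) + toL2 (interactionField hp t (w t))) =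
        -Complex.I • unitaryGroup absSymbol t (absD (w t)) + toL2 (powerH1 hp (h1Group absSymbol t (w t))) := by
      rw [map_add, map_smul]
      congr 1
      change unitaryGroup absSymbol t (unitaryGroup absSymbol (-t) _) = _
      rw [← unitaryGroup_add, add_neg_cancel, unitaryGroup_zero]
    rw [h4] at h3
    exact h3

/-! ### Maximal solutions -/

theorem timeInterval_mono {S T : ℝ≥0∞} (h : S ≤ T) : timeInterval S ⊆ timeInterval T :=
  fun _ ht => ⟨ht.1, ht.2.trans_le h⟩

/-- At a point of [0, S), the interval [0, S) is a neighbourhood within [0, T), so continuity and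
derivatives transfer from one interval to the other. -/
theorem timeInterval_mem_nhdsWithin {S T : ℝ≥0∞} {t : ℝ} (ht : t ∈ timeInterval S) :
    timeInterval S ∈ 𝓝[timeInterval T] t := by
  have h : {s : ℝ | ENNReal.ofReal s < S} ∈ 𝓝 t :=
    (isOpen_lt ENNReal.continuous_ofReal continuous_const).mem_nhds ht.2
  filter_upwards [self_mem_nhdsWithin, mem_nhdsWithin_of_mem_nhds h] with s hs1 hs2
  exact ⟨hs1.1, hs2⟩

/-- A function that agrees near each time with a solution is a solution. -/
theorem isH1Solution_of_locally {p : ℝ} {u₀ : H1} {T : ℝ≥0∞} {u : ℝ → H1} (h0 : u 0 = u₀)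
    (h : ∀ t ∈ timeInterval T, ∃ (S : ℝ≥0∞) (v : ℝ → H1), t ∈ timeInterval S ∧
      IsH1Solution p u₀ S v ∧ EqOn u v (timeInterval S)) : IsH1Solution p u₀ T u := by
  refine ⟨h0, fun t ht => ?_, fun t ht => ?_⟩
  · obtain ⟨S, v, htS, hv, huv⟩ := h t ht
    exact ((hv.continuousOn t htS).congr huv (huv htS)).mono_of_mem_nhdsWithin
      (timeInterval_mem_nhdsWithin htS)
  · obtain ⟨S, v, htS, hv, huv⟩ := h t ht
    obtain ⟨a, b, ha, hb, hd⟩ := hv.equation t htS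
    rw [← huv htS] at ha hb
    refine ⟨a, b, ha, hb, (hd.congr (fun s hs => ?_) ?_).mono_of_mem_nhdsWithin
      (timeInterval_mem_nhdsWithin htS)⟩
    · rw [huv hs]
    · rw [huv htS]

/-- Every solution extends to a maximal one. -/
theorem exists_isH1SolutionWithLifespan {p : ℝ} {u₀ : H1} {T₀ : ℝ≥0∞} (hT₀ : 0 < T₀)
    {u : ℝ → H1} (hu : IsH1Solution p u₀ T₀ u) :
    ∃ (T : ℝ≥0∞) (v : ℝ → H1), IsH1SolutionWithLifespan p u₀ T v ∧ T₀ ≤ T := by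
  let α := {q : ℝ≥0∞ × (ℝ → H1) // IsH1Solution p u₀ q.1 q.2 ∧ T₀ ≤ q.1}
  -- Zorn's lemma is applied to the extension preorder, so no uniqueness of solutions is needed. It
  -- is not antisymmetric, because values outside the time interval are free.
  let r : α → α → Prop := fun a b => a.1.1 ≤ b.1.1 ∧ EqOn b.1.2 a.1.2 (timeInterval a.1.1)
  have : Nonempty α := ⟨⟨(T₀, u), hu, le_rfl⟩⟩
  obtain ⟨m, hm⟩ : ∃ m : α, ∀ a, r m a → r a m := by
    refine exists_maximal_of_nonempty_chains_bounded (fun c hc hne => ?_)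
      fun {a b c} hab hbc => ⟨hab.1.trans hbc.1, fun t ht => ?_⟩
    · have hagree : ∀ a ∈ c, ∀ b ∈ c, ∀ t ∈ timeInterval a.1.1, t ∈ timeInterval b.1.1 →
          a.1.2 t = b.1.2 t := by
        intro a ha b hb t hta htb
        rcases eq_or_ne a b with rfl | hab
        · rfl
        · rcases hc ha hb hab with h | h
          · exact (h.2 hta).symm
          · exact h.2 htb
      classical
      let v : ℝ → H1 := fun t => if h : ∃ a ∈ c, t ∈ timeInterval a.1.1 then h.choose.1.2 t else u₀
      have hv : ∀ a ∈ c, EqOn v a.1.2 (timeInterval a.1.1) := by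
        intro a ha t ht
        have h : ∃ a ∈ c, t ∈ timeInterval a.1.1 := ⟨a, ha, ht⟩
        have h2 : v t = h.choose.1.2 t := dif_pos h
        rw [h2]
        exact hagree _ h.choose_spec.1 a ha t h.choose_spec.2 ht
      obtain ⟨a₀, ha₀⟩ := hne
      have hle : ∀ a ∈ c, a.1.1 ≤ ⨆ a ∈ c, a.1.1 := fun a ha => le_iSup₂ (f := fun a _ => a.1.1) a ha
      have hsol : IsH1Solution p u₀ (⨆ a ∈ c, a.1.1) v := by
        -- Every time below the supremum already lies in the interval of some member of the chain,
        -- with which v agrees on that whole interval.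
        refine isH1Solution_of_locally ?_ fun t ht => ?_
        · have h0 : (0 : ℝ) ∈ timeInterval a₀.1.1 :=
            ⟨le_rfl, by rw [ENNReal.ofReal_zero]; exact hT₀.trans_le a₀.2.2⟩
          rw [hv a₀ ha₀ h0]
          exact a₀.2.1.initial
        · obtain ⟨a, ha⟩ := lt_iSup_iff.1 ht.2
          obtain ⟨hac, hlt⟩ := lt_iSup_iff.1 ha
          exact ⟨a.1.1, a.1.2, ⟨ht.1, hlt⟩, a.2.1, hv a hac⟩
      exact ⟨⟨(_, v), hsol, a₀.2.2.trans (hle a₀ ha₀)⟩, fun a ha => ⟨hle a ha, hv a ha⟩⟩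
    · rw [hbc.2 (timeInterval_mono hab.1 ht), hab.2 ht]
  refine ⟨m.1.1, m.1.2, ⟨hT₀.trans_le m.2.2, m.2.1, fun T' v hT' hv heq => ?_⟩, m.2.2⟩
  exact absurd (hm ⟨(T', v), hv, m.2.2.trans hT'.le⟩ ⟨hT'.le, heq⟩).1 (not_le.2 hT')

end FractionalGL

end

/-! ### The lower bound on the lifespan -/

open FractionalGL in
theorem proposition1p3 (p : ℝ) (hp : 1 < p) (f : H1) :
    ∃ C : ℝ, 0 < C ∧ ∃ R₀ : ℝ, 0 < R₀ ∧ ∀ R : ℝ, R₀ ≤ R →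
      ∃ (T : ℝ≥0∞) (u : ℝ → H1),
        IsH1SolutionWithLifespan p ((R : ℂ) • f) T u ∧
          ENNReal.ofReal (C * R ^ (-(p - 1))) ≤ T := by
  -- The radius is M = AR/2 = 2R(‖f‖ + 1), so that ‖Rf‖ ≤ M/2 and 2M = AR. The constant C solves T ·
  -- 2p(AR)^{p-1} = 1/2 for T = C R^{-(p-1)}; the summand 1 keeps A positive when f = 0.
  set A : ℝ := 4 * (‖f‖ + 1) with hA
  have hA0 : 0 < A := by positivity
  refine ⟨1 / (4 * (p * A ^ (p - 1))), by positivity, 1, one_pos, fun R hR => ?_⟩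
  have hR0 : 0 < R := one_pos.trans_le hR
  set T := 1 / (4 * (p * A ^ (p - 1))) * R ^ (-(p - 1)) with hT
  have hT0 : 0 < T := by positivity
  have hu₀ : ‖(R : ℂ) • f‖ ≤ A / 2 * R / 2 := by
    rw [norm_smul, Complex.norm_real, Real.norm_of_nonneg hR0.le, hA]
    linarith
  have hTM : T * (2 * (p * (2 * (A / 2 * R)) ^ (p - 1))) ≤ 1 / 2 := by
    have h1 : 2 * (A / 2 * R) = A * R := by ring
    have h2 : 0 < A ^ (p - 1) := by positivity
    have h3 : 0 < R ^ (p - 1) := by positivity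
    rw [h1, Real.mul_rpow hA0.le hR0.le, hT, Real.rpow_neg hR0.le]
    apply le_of_eq
    field_simp
    norm_num
  obtain ⟨u, hu⟩ := exists_isH1Solution hp hT0.le hu₀ hTM
  exact exists_isH1SolutionWithLifespan (ENNReal.ofReal_pos.2 hT0) hu
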